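/- Let $G$ be a finite group that contains a unique subgroup $A$ of order $2$. Then $A$ is $\omega$-admissible for every normalized $3$-cocycle $\omega\in Z^3(G,\mathbb{C}^\times)$ (trivial action), hence for a normalized representative $\omega$ of every class in $H^3(G,\mathbb{C}^\times)$. That is, the following two conditions hold. (a) $A\subseteq Z_\omega(G)$, where $Z_\omega(G)$ is the subgroup of all $g$ in the center $Z(G)$ for which the $2$-cocycle $\gamma_g$ is a coboundary, i.e. lies in $B^2(G,\mathbb{C}^\times)$. (b) The short exact sequence $1\to\widehat G\xrightarrow{\iota}\Gamma_0^\omega(G,A)\xrightarrow{p}A\to 1$ splits, i.e. there is a group homomorphism $s:A\to\Gamma_0^\omega(G,A)$ with $p\circ s=\mathrm{id}_A$. Here $x^g=g^{-1}xg$ and $$\theta_g(x,y)=\frac{\omega(g,x,y)\,\omega(x,y,g^{xy})}{\omega(x,g^x,y)},\qquad \gamma_g(x,y)=\frac{\omega(x,y,g)\,\omega(g,x^g,y^g)}{\omega(x,g,y^g)}.$$ The twisted quantum double $D^\omega(G)$ is the complex algebra with basis $\{e_gx : g,x\in G\}$, product $e_gx\cdot e_hy=\theta_g(x,y)\,\delta_{g^x,h}\,e_g\,xy$,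 unit $\sum_g e_g1$, and comultiplication $\Delta(e_gx)=\sum_{hk=g}\gamma_x(h,k)\,e_hx\otimes e_kx$. The group $\Gamma_0^\omega(G)$ consists of the central units $u\in D^\omega(G)$ that are group-like, $\Delta(u)=u\otimes u$; each of them has the form $u=\sum_g\tau(g)\,e_gx$ for a unique $x\in Z_\omega(G)$ and a unique $\tau:G\to\mathbb{C}^\times$, and $p(u):=x$. Finally $\widehat G=\mathrm{Hom}(G,\mathbb{C}^\times)$, $\iota(\chi)=\sum_g\chi(g)\,e_g1$, and $\Gamma_0^\omega(G,A)=p^{-1}(A)$. -/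

import Mathlib

/-- A normalized 3-cocycle on `G` with values in the trivial `G`-module `ℂˣ`. -/
structure NormalizedCocycle3 (G : Type*) [Group G] where
  toFun : G → G → G → ℂˣ
  cocycle : ∀ g h k l, toFun h k l * toFun g (h * k) l * toFun g h k =
    toFun (g * h) k l * toFun g h (k * l)
  map_one_left : ∀ h k, toFun 1 h k = 1
  map_one_mid : ∀ h k, toFun h 1 k = 1
  map_one_right : ∀ h k, toFun h k 1 = 1

namespace NormalizedCocycle3

variable {G : Type*} [Group G] (ω : NormalizedCocycle3 G)

/-- `θ_g(x,y) = ω(g,x,y) ω(x,y,g^{xy}) / ω(x,g^x,y)`, where `g^x = x⁻¹ g x`. -/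
def theta (g x y : G) : ℂˣ :=
  ω.toFun g x y * ω.toFun x y ((x * y)⁻¹ * g * (x * y)) / ω.toFun x (x⁻¹ * g * x) y

/-- `γ_g(x,y) = ω(x,y,g) ω(g,x^g,y^g) / ω(x,g,y^g)`, where `x^g = g⁻¹ x g`. -/
def gamma (g x y : G) : ℂˣ :=
  ω.toFun x y g * ω.toFun g (g⁻¹ * x * g) (g⁻¹ * y * g) / ω.toFun x g (g⁻¹ * y * g)

theorem theta_mul (g x y z : G) :
    ω.theta g x y * ω.theta g (x * y) z = ω.theta (x⁻¹ * g * x) y z * ω.theta g x (y * z) := by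
  have h1 := congrArg Additive.ofMul (ω.cocycle g x y z)
  have h2 := congrArg Additive.ofMul (ω.cocycle x (x⁻¹ * g * x) y z)
  have h3 := congrArg Additive.ofMul (ω.cocycle x y ((x * y)⁻¹ * g * (x * y)) z)
  have h4 := congrArg Additive.ofMul (ω.cocycle x y z ((x * y * z)⁻¹ * g * (x * y * z)))
  apply Additive.ofMul.injective
  simp only [theta, ofMul_mul, ofMul_div, mul_inv_rev, mul_assoc, mul_inv_cancel_left] at *
  linear_combination (norm := abel) h1 - h2 + h3 - h4

theorem theta_gamma (g h x y : G) :
    ω.theta g x y * ω.theta h x y * ω.gamma x g h * ω.gamma y (x⁻¹ * g * x) (x⁻¹ * h * x) =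
      ω.theta (g * h) x y * ω.gamma (x * y) g h := by
  have h1 := congrArg Additive.ofMul (ω.cocycle g h x y)
  have h2 := congrArg Additive.ofMul (ω.cocycle g x (x⁻¹ * h * x) y)
  have h3 := congrArg Additive.ofMul (ω.cocycle x (x⁻¹ * g * x) (x⁻¹ * h * x) y)
  have h4 := congrArg Additive.ofMul (ω.cocycle g x y ((x * y)⁻¹ * h * (x * y)))
  have h5 := congrArg Additive.ofMul
    (ω.cocycle x (x⁻¹ * g * x) y ((x * y)⁻¹ * h * (x * y)))
  have h6 := congrArg Additive.ofMul
    (ω.cocycle x y ((x * y)⁻¹ * g * (x * y)) ((x * y)⁻¹ * h * (x * y)))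
  apply Additive.ofMul.injective
  simp only [theta, gamma, ofMul_mul, ofMul_div, mul_inv_rev, mul_assoc,
    mul_inv_cancel_left] at *
  linear_combination (norm := abel) h1 - h2 + h3 + h4 - h5 + h6

/-- For central `x`, the failure of `θ_g(x,y)` and `θ_g(y,x)` to agree, through `γ_x`. -/
theorem theta_comm_gamma {x : G} (hx : x ∈ Subgroup.center G) (g y : G) :
    ω.theta g x y * ω.gamma x g y = ω.theta g y x * ω.gamma x y (y⁻¹ * g * y) := by
  rw [Subgroup.mem_center_iff] at hx
  have hc : ∀ a : G, x⁻¹ * a * x = a := fun a => by rw [mul_assoc, hx, inv_mul_cancel_left]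
  have e1 : (x * y)⁻¹ * g * (x * y) = y⁻¹ * g * y := by
    rw [show (x * y)⁻¹ * g * (x * y) = y⁻¹ * (x⁻¹ * g * x) * y by group, hc]
  have e2 : (y * x)⁻¹ * g * (y * x) = y⁻¹ * g * y := by
    rw [show (y * x)⁻¹ * g * (y * x) = x⁻¹ * (y⁻¹ * g * y) * x by group, hc]
  apply Additive.ofMul.injective
  simp only [theta, gamma, ofMul_mul, ofMul_div, hc, e1, e2]
  abel

@[simp] theorem theta_one_left (x y : G) : ω.theta 1 x y = 1 := by
  simp [theta, ω.map_one_left, ω.map_one_mid, ω.map_one_right]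

@[simp] theorem theta_one_mid (g y : G) : ω.theta g 1 y = 1 := by
  simp [theta, ω.map_one_left, ω.map_one_mid]

@[simp] theorem theta_one_right (g x : G) : ω.theta g x 1 = 1 := by
  simp [theta, ω.map_one_mid, ω.map_one_right]

@[simp] theorem gamma_one_left (x y : G) : ω.gamma 1 x y = 1 := by
  simp [gamma, ω.map_one_left, ω.map_one_mid, ω.map_one_right]

@[simp] theorem gamma_one_mid (g y : G) : ω.gamma g 1 y = 1 := by
  simp [gamma, ω.map_one_left, ω.map_one_mid]

@[simp] theorem gamma_one_right (g x : G) : ω.gamma g x 1 = 1 := by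
  simp [gamma, ω.map_one_mid, ω.map_one_right]

end NormalizedCocycle3

/-- The underlying vector space of the twisted quantum double `D^ω(G)`; the basis vector attached
to `(g, x)` is written `e_g x`. -/
def TwistedDouble {G : Type*} [Group G] (_ω : NormalizedCocycle3 G) : Type _ := G × G →₀ ℂ

namespace TwistedDouble

open scoped TensorProduct
section Algebra

variable {G : Type*} [Group G] (ω : NormalizedCocycle3 G)

noncomputable instance : AddCommGroup (TwistedDouble ω) :=
  inferInstanceAs (AddCommGroup (G × G →₀ ℂ))

noncomputable instance : Module ℂ (TwistedDouble ω) :=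
  inferInstanceAs (Module ℂ (G × G →₀ ℂ))

/-- The basis `(e_g x)` of `D^ω(G)`. -/
noncomputable def basis : Module.Basis (G × G) ℂ (TwistedDouble ω) :=
  (Finsupp.basisSingleOne : Module.Basis (G × G) ℂ (G × G →₀ ℂ))

/-- The basis vector `e_g x`. -/
noncomputable def e (g x : G) : TwistedDouble ω := basis ω (g, x)

variable {ω} in
theorem induction {P : TwistedDouble ω → Prop} (a : TwistedDouble ω) (zero : P 0)
    (add : ∀ a b, P a → P b → P (a + b)) (smul : ∀ (c : ℂ) a, P a → P (c • a))
    (basis_mem : ∀ g x, P (e ω g x)) : P a := by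
  have : a ∈ Submodule.span ℂ (Set.range (basis ω)) := by
    rw [(basis ω).span_eq]; trivial
  induction this using Submodule.span_induction with
  | mem x h => obtain ⟨⟨g, x⟩, rfl⟩ := h; exact basis_mem g x
  | zero => exact zero
  | add a b _ _ ha hb => exact add a b ha hb
  | smul c a _ ha => exact smul c a ha

open scoped Classical in
/-- The multiplication `e_g x · e_h y = θ_g(x,y) δ_{g^x,h} e_g xy`, extended bilinearly. -/
noncomputable def mulMap : TwistedDouble ω →ₗ[ℂ] TwistedDouble ω →ₗ[ℂ] TwistedDouble ω :=
  (basis ω).constr ℂ fun p => (basis ω).constr ℂ fun q =>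
    if p.2⁻¹ * p.1 * p.2 = q.1 then (ω.theta p.1 p.2 q.2 : ℂ) • e ω p.1 (p.2 * q.2) else 0

noncomputable instance : Mul (TwistedDouble ω) := ⟨fun a b => mulMap ω a b⟩

theorem mul_def (a b : TwistedDouble ω) : a * b = mulMap ω a b := rfl

open scoped Classical in
theorem e_mul_e (g x h y : G) : e ω g x * e ω h y =
    if x⁻¹ * g * x = h then (ω.theta g x y : ℂ) • e ω g (x * y) else 0 := by
  simp [mul_def, mulMap, e]

theorem add_mul' (a b c : TwistedDouble ω) : (a + b) * c = a * c + b * c := by simp [mul_def]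
theorem mul_add' (a b c : TwistedDouble ω) : a * (b + c) = a * b + a * c := by simp [mul_def]
theorem zero_mul' (a : TwistedDouble ω) : 0 * a = 0 := by simp [mul_def]
theorem mul_zero' (a : TwistedDouble ω) : a * 0 = 0 := by simp [mul_def]
theorem smul_mul' (c : ℂ) (a b : TwistedDouble ω) : (c • a) * b = c • (a * b) := by simp [mul_def]
theorem mul_smul' (c : ℂ) (a b : TwistedDouble ω) : a * (c • b) = c • (a * b) := by simp [mul_def]

theorem sum_mul' {ι : Type*} (s : Finset ι) (f : ι → TwistedDouble ω) (b : TwistedDouble ω) :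
    (∑ i ∈ s, f i) * b = ∑ i ∈ s, f i * b := by simp [mul_def]

theorem mul_sum' {ι : Type*} (s : Finset ι) (f : ι → TwistedDouble ω) (b : TwistedDouble ω) :
    b * (∑ i ∈ s, f i) = ∑ i ∈ s, b * f i := by simp [mul_def]

theorem mul_assoc' (a b c : TwistedDouble ω) : a * b * c = a * (b * c) := by
  induction a using induction with
  | zero => simp only [zero_mul']
  | add a a' h h' => simp only [add_mul', h, h']
  | smul r a h => simp only [smul_mul', h]
  | basis_mem g x =>
  induction b using induction with
  | zero => simp only [zero_mul', mul_zero']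
  | add a a' h h' => simp only [add_mul', mul_add', h, h']
  | smul r a h => simp only [smul_mul', mul_smul', h]
  | basis_mem h y =>
  induction c using induction with
  | zero => simp only [mul_zero']
  | add a a' h h' => simp only [mul_add', h, h']
  | smul r a h => simp only [mul_smul', h]
  | basis_mem k z =>
    simp only [e_mul_e]
    by_cases h1 : x⁻¹ * g * x = h
    · subst h1
      by_cases h2 : y⁻¹ * (x⁻¹ * g * x) * y = k
      · subst h2
        have h3 : (x * y)⁻¹ * g * (x * y) = y⁻¹ * (x⁻¹ * g * x) * y := by group
        have := congrArg Units.val (ω.theta_mul g x y z)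
        simp only [if_true, smul_mul', mul_smul', e_mul_e, h3, smul_smul, mul_assoc x y z]
        simp only [Units.val_mul] at this
        rw [this]
      · have h3 : ¬ (x * y)⁻¹ * g * (x * y) = k := by
          rwa [show (x * y)⁻¹ * g * (x * y) = y⁻¹ * (x⁻¹ * g * x) * y by group]
        simp only [if_true, smul_mul', mul_zero', e_mul_e, if_neg h2, if_neg h3, smul_zero]
    · simp only [if_neg h1, zero_mul']
      split_ifs with h2
      · simp [mul_smul', e_mul_e, h1]
      · rw [mul_zero']

end Algebra

section Double

variable {G : Type*} [Group G] [Fintype G] (ω : NormalizedCocycle3 G)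

/-- The unit `∑_g e_g 1`. -/
noncomputable instance : One (TwistedDouble ω) := ⟨∑ g : G, e ω g 1⟩

theorem one_def : (1 : TwistedDouble ω) = ∑ g : G, e ω g 1 := rfl

theorem one_mul' (a : TwistedDouble ω) : 1 * a = a := by
  induction a using induction with
  | zero => simp only [mul_zero']
  | add a a' h h' => simp only [mul_add', h, h']
  | smul r a h => simp only [mul_smul', h]
  | basis_mem k z =>
    classical
    simp only [one_def, sum_mul', e_mul_e, inv_one, one_mul, mul_one]
    rw [Finset.sum_eq_single k] <;> simp +contextual

theorem mul_one' (a : TwistedDouble ω) : a * 1 = a := by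
  induction a using induction with
  | zero => simp only [zero_mul']
  | add a a' h h' => simp only [add_mul', h, h']
  | smul r a h => simp only [smul_mul', h]
  | basis_mem k z =>
    classical
    simp only [one_def, mul_sum', e_mul_e, mul_one]
    rw [Finset.sum_eq_single (z⁻¹ * k * z)] <;> simp +contextual [eq_comm]

noncomputable instance : Ring (TwistedDouble ω) where
  __ := (inferInstance : AddCommGroup (TwistedDouble ω))
  mul := (· * ·)
  one := 1
  left_distrib := mul_add' ω
  right_distrib := add_mul' ω
  zero_mul := zero_mul' ω
  mul_zero := mul_zero' ω
  mul_assoc := mul_assoc' ω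
  one_mul := one_mul' ω
  mul_one := mul_one' ω

noncomputable instance : Algebra ℂ (TwistedDouble ω) :=
  Algebra.ofModule (smul_mul' ω) (fun c a b => mul_smul' ω c a b)

/-- The comultiplication as a linear map:
`Δ(e_g x) = ∑_{hk = g} γ_x(h,k) e_h x ⊗ e_k x`. -/
noncomputable def comulMap : TwistedDouble ω →ₗ[ℂ] TwistedDouble ω ⊗[ℂ] TwistedDouble ω :=
  (basis ω).constr ℂ fun p => ∑ h : G,
    (ω.gamma p.2 h (h⁻¹ * p.1) : ℂ) • (e ω h p.2 ⊗ₜ[ℂ] e ω (h⁻¹ * p.1) p.2)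

theorem comulMap_e (g x : G) : comulMap ω (e ω g x) = ∑ h : G,
    (ω.gamma x h (h⁻¹ * g) : ℂ) • (e ω h x ⊗ₜ[ℂ] e ω (h⁻¹ * g) x) := by
  rw [comulMap, e, Module.Basis.constr_basis]

theorem comulMap_one : comulMap ω 1 = 1 := by
  rw [Algebra.TensorProduct.one_def, one_def, map_sum, TensorProduct.sum_tmul]
  simp only [comulMap_e, TensorProduct.tmul_sum]
  rw [Finset.sum_comm]
  refine Finset.sum_congr rfl fun h _ => ?_
  simp only [NormalizedCocycle3.gamma_one_left, Units.val_one, one_smul]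
  exact Fintype.sum_equiv (Equiv.mulLeft h⁻¹) _ _ fun g => rfl

theorem comulMap_mul (a b : TwistedDouble ω) :
    comulMap ω (a * b) = comulMap ω a * comulMap ω b := by
  classical
  induction a using induction with
  | zero => simp
  | add a a' h h' => simp only [add_mul, map_add, h, h']
  | smul r a h => simp only [smul_mul_assoc, map_smul, h]
  | basis_mem g x =>
  induction b using induction with
  | zero => simp
  | add a a' h h' => simp only [mul_add, map_add, h, h']
  | smul r a h => simp only [mul_smul_comm, map_smul, h]
  | basis_mem k y =>
    rw [e_mul_e, comulMap_e, comulMap_e, Finset.sum_mul_sum]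
    have key : ∀ h : G, ∑ l : G, (ω.gamma x h (h⁻¹ * g) : ℂ) • (e ω h x ⊗ₜ[ℂ] e ω (h⁻¹ * g) x) *
        (ω.gamma y l (l⁻¹ * k) : ℂ) • (e ω l y ⊗ₜ[ℂ] e ω (l⁻¹ * k) y) =
        if x⁻¹ * g * x = k then (ω.theta g x y : ℂ) • (ω.gamma (x * y) h (h⁻¹ * g) : ℂ) •
          (e ω h (x * y) ⊗ₜ[ℂ] e ω (h⁻¹ * g) (x * y)) else 0 := by
      intro h
      rw [Finset.sum_eq_single (x⁻¹ * h * x)]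
      · simp only [smul_mul_smul_comm, Algebra.TensorProduct.tmul_mul_tmul, e_mul_e, if_true]
        by_cases hk : x⁻¹ * g * x = k
        · subst hk
          have h1 : (x⁻¹ * h * x)⁻¹ * (x⁻¹ * g * x) = x⁻¹ * (h⁻¹ * g) * x := by group
          have := congrArg Units.val (ω.theta_gamma h (h⁻¹ * g) x y)
          simp only [Units.val_mul, mul_inv_cancel_left] at this
          simp only [h1, if_true, TensorProduct.smul_tmul_smul, smul_smul]
          congr 1
          linear_combination this
        · have h1 : ¬ x⁻¹ * (h⁻¹ * g) * x = (x⁻¹ * h * x)⁻¹ * k := by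
            intro h2
            apply hk
            calc x⁻¹ * g * x = x⁻¹ * h * x * (x⁻¹ * (h⁻¹ * g) * x) := by group
              _ = k := by rw [h2]; group
          simp only [if_neg hk, if_neg h1, TensorProduct.tmul_zero, smul_zero]
      · intro l _ hl
        simp only [smul_mul_smul_comm, Algebra.TensorProduct.tmul_mul_tmul, e_mul_e,
          if_neg hl.symm, TensorProduct.zero_tmul, smul_zero]
      · simp
    simp only [key]
    split_ifs with hk
    · rw [map_smul, comulMap_e, Finset.smul_sum]
    · simp

/-- The comultiplication `Δ : D^ω(G) → D^ω(G) ⊗ D^ω(G)` as a homomorphism of algebras. -/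
noncomputable def comul : TwistedDouble ω →ₐ[ℂ] TwistedDouble ω ⊗[ℂ] TwistedDouble ω :=
  AlgHom.ofLinearMap (comulMap ω) (comulMap_one ω) (comulMap_mul ω)

/-- The element `∑_g τ(g) e_g x`. -/
noncomputable def elt (τ : G → ℂˣ) (x : G) : TwistedDouble ω := ∑ g : G, (τ g : ℂ) • e ω g x

theorem elt_one : elt ω 1 1 = 1 := by simp [elt, one_def]

theorem repr_elt (τ : G → ℂˣ) (x g y : G) [Decidable (x = y)] :
    (basis ω).repr (elt ω τ x) (g, y) = if x = y then (τ g : ℂ) else 0 := by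
  classical
  simp only [elt, e, map_sum, map_smul, Module.Basis.repr_self, Finsupp.coe_finsetSum,
    Finset.sum_apply, Finsupp.smul_apply, Finsupp.single_apply, Prod.mk.injEq, smul_eq_mul]
  rw [Finset.sum_eq_single g] <;> simp +contextual

theorem elt_injective {τ σ : G → ℂˣ} {x y : G} (h : elt ω τ x = elt ω σ y) : τ = σ ∧ x = y := by
  classical
  have h1 : ∀ g z, (if x = z then (τ g : ℂ) else 0) = if y = z then (σ g : ℂ) else 0 := by
    intro g z; rw [← repr_elt ω, ← repr_elt ω, h]
  have hxy : x = y := by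
    by_contra hne
    have := h1 1 x
    rw [if_pos rfl, if_neg (Ne.symm hne)] at this
    exact (τ 1).ne_zero this
  subst hxy
  refine ⟨funext fun g => Units.ext ?_, rfl⟩
  simpa using h1 g x

theorem elt_mul_elt {x : G} (hx : x ∈ Subgroup.center G) (τ σ : G → ℂˣ) (y : G) :
    elt ω τ x * elt ω σ y = elt ω (fun g => ω.theta g x y * (τ g * σ g)) (x * y) := by
  classical
  rw [Subgroup.mem_center_iff] at hx
  have hc : ∀ a : G, x⁻¹ * a * x = a := fun a => by rw [mul_assoc, hx, inv_mul_cancel_left]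
  simp only [elt, Finset.sum_mul_sum]
  refine Finset.sum_congr rfl fun g _ => ?_
  rw [Finset.sum_eq_single g]
  · simp only [smul_mul_smul_comm, e_mul_e, hc, if_true, smul_smul, Units.val_mul]
    congr 1; ring
  · intro h _ hh
    simp only [smul_mul_smul_comm, e_mul_e, hc, if_neg hh.symm, smul_zero]
  · simp

theorem elt_mem_center {x : G} (hx : x ∈ Subgroup.center G) {τ : G → ℂˣ}
    (hτ : ∀ h k, ω.gamma x h k = τ h * τ k / τ (h * k)) :
    elt ω τ x ∈ Submonoid.center (TwistedDouble ω) := by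
  classical
  have hx' := Subgroup.mem_center_iff.1 hx
  have hc : ∀ a : G, x⁻¹ * a * x = a := fun a => by rw [mul_assoc, hx', inv_mul_cancel_left]
  rw [Submonoid.mem_center_iff]
  intro a
  induction a using induction with
  | zero => simp
  | add a b ha hb => rw [add_mul, mul_add, ha, hb]
  | smul c a ha => rw [smul_mul_assoc, mul_smul_comm, ha]
  | basis_mem g y =>
    simp only [elt, Finset.mul_sum, Finset.sum_mul, mul_smul_comm, smul_mul_assoc, e_mul_e, hc]
    rw [Finset.sum_eq_single (y⁻¹ * g * y), Finset.sum_eq_single g]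
    · simp only [if_true, smul_smul, hx' y]
      congr 1
      rw [← Units.val_mul, ← Units.val_mul]
      congr 1
      have h1 := ω.theta_comm_gamma hx g y
      rw [hτ, hτ, show y * (y⁻¹ * g * y) = g * y by group] at h1
      have h2 := congrArg Additive.ofMul h1
      apply Additive.ofMul.injective
      simp only [ofMul_mul, ofMul_div] at h2 ⊢
      linear_combination (norm := abel) -h2
    · intro h _ hh; simp [hh]
    · simp
    · intro h _ hh; simp [hh.symm]
    · simp

theorem comul_elt {x : G} {τ : G → ℂˣ} (hτ : ∀ h k, ω.gamma x h k = τ h * τ k / τ (h * k)) :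
    comul ω (elt ω τ x) = elt ω τ x ⊗ₜ[ℂ] elt ω τ x := by
  change comulMap ω _ = _
  simp only [elt, map_sum, map_smul, comulMap_e, TensorProduct.sum_tmul, TensorProduct.tmul_sum,
    Finset.smul_sum, TensorProduct.smul_tmul_smul, smul_smul]
  rw [Finset.sum_comm]
  conv_rhs => rw [Finset.sum_comm]
  refine Finset.sum_congr rfl fun h _ => ?_
  refine Fintype.sum_equiv (Equiv.mulLeft h⁻¹) _ _ fun g => ?_
  simp only [Equiv.coe_mulLeft]
  congr 1
  rw [hτ, ← Units.val_mul, ← Units.val_mul, mul_inv_cancel_left, mul_div_cancel]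

theorem repr_comul (u : TwistedDouble ω) (h k x y : G) [Decidable (x = y)] :
    ((basis ω).tensorProduct (basis ω)).repr (comul ω u) ((h, x), (k, y)) =
      if x = y then (ω.gamma x h k : ℂ) * (basis ω).repr u (h * k, x) else 0 := by
  classical
  rw [show comul ω u = comulMap ω u from rfl]
  induction u using induction with
  | zero => simp
  | add a b ha hb => simp only [map_add, Finsupp.add_apply, ha, hb]; split_ifs <;> ring
  | smul c a ha => simp only [map_smul, Finsupp.smul_apply, smul_eq_mul, ha]; split_ifs <;> ring
  | basis_mem g z =>
    rw [comulMap_e]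
    simp only [e, map_sum, map_smul, Finsupp.coe_finsetSum, Finset.sum_apply,
      Finsupp.smul_apply, Module.Basis.tensorProduct_repr_tmul_apply, Module.Basis.repr_self,
      Finsupp.single_apply, Prod.mk.injEq, smul_eq_mul]
    rw [Finset.sum_eq_single h]
    · by_cases hz : z = x
      · subst hz
        by_cases hk : g = h * k
        · subst hk
          simp
        · have : ¬ h⁻¹ * g = k := fun h' => hk (by rw [← h']; group)
          simp [this, hk]
      · simp [hz]
    · intro l _ hl; simp [hl]
    · simp

/-- Every nonzero `u` with `Δ(u) = u ⊗ u` is of the form `∑_g τ(g) e_g x`. -/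
theorem exists_eq_elt {u : TwistedDouble ω} (h0 : u ≠ 0) (hu : comul ω u = u ⊗ₜ[ℂ] u) :
    ∃ (x : G) (τ : G → ℂˣ), (∀ h k, ω.gamma x h k = τ h * τ k / τ (h * k)) ∧ u = elt ω τ x := by
  classical
  set c : G → G → ℂ := fun g x => (basis ω).repr u (g, x) with hcdef
  have key : ∀ h x k y, c h x * c k y = if x = y then (ω.gamma x h k : ℂ) * c (h * k) x else 0 := by
    intro h x k y
    rw [← repr_comul ω u h k x y, hu, Module.Basis.tensorProduct_repr_tmul_apply, smul_eq_mul,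
      mul_comm]
  obtain ⟨⟨g, x⟩, hgx⟩ : ∃ p, (basis ω).repr u p ≠ 0 := by
    by_contra hcon
    push Not at hcon
    exact h0 ((basis ω).repr.map_eq_zero_iff.1 (Finsupp.ext hcon))
  change c g x ≠ 0 at hgx
  have hne : ∀ h, c h x ≠ 0 := by
    intro h hh
    have h1 := key h x (h⁻¹ * g) x
    rw [if_pos rfl, hh, zero_mul, mul_inv_cancel_left] at h1
    exact mul_ne_zero (Units.ne_zero _) hgx h1.symm
  refine ⟨x, fun h => Units.mk0 _ (hne h), fun h k => ?_, ?_⟩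
  · rw [eq_div_iff_mul_eq']
    ext
    simpa [mul_comm] using (key h x k x).symm
  · apply (basis ω).repr.injective
    ext ⟨h, y⟩
    rw [repr_elt]
    by_cases hxy : x = y
    · subst hxy; simp [hcdef]
    · have h1 := key g x h y
      rw [if_neg hxy] at h1
      rw [if_neg hxy]
      exact (mul_eq_zero.1 h1).resolve_left hgx

end Double

section CentralGroupLike

variable {G : Type*} [Group G] (ω : NormalizedCocycle3 G)

theorem gamma_mul_eq {x y : G} (hx : x ∈ Subgroup.center G) {τ σ : G → ℂˣ}
    (hτ : ∀ h k, ω.gamma x h k = τ h * τ k / τ (h * k))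
    (hσ : ∀ h k, ω.gamma y h k = σ h * σ k / σ (h * k)) (h k : G) :
    ω.gamma (x * y) h k = (ω.theta h x y * (τ h * σ h)) * (ω.theta k x y * (τ k * σ k)) /
      (ω.theta (h * k) x y * (τ (h * k) * σ (h * k))) := by
  have hx' := Subgroup.mem_center_iff.1 hx
  have hc : ∀ a : G, x⁻¹ * a * x = a := fun a => by rw [mul_assoc, hx', inv_mul_cancel_left]
  have h1 := ω.theta_gamma h k x y
  rw [hτ, hc, hc, hσ] at h1
  have h2 := congrArg Additive.ofMul h1
  apply Additive.ofMul.injective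
  simp only [ofMul_mul, ofMul_div] at h2 ⊢
  linear_combination (norm := abel) -h2

/-- `Z_ω(G)`: the central elements `x` for which the 2-cocycle `γ_x` is a coboundary. -/
def Z : Subgroup G where
  carrier := {x | x ∈ Subgroup.center G ∧
    ∃ τ : G → ℂˣ, ∀ h k, ω.gamma x h k = τ h * τ k / τ (h * k)}
  one_mem' := ⟨one_mem _, 1, by simp⟩
  mul_mem' := by
    rintro x y ⟨hx, τ, hτ⟩ ⟨hy, σ, hσ⟩
    exact ⟨mul_mem hx hy, _, gamma_mul_eq ω hx hτ hσ⟩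
  inv_mem' := by
    rintro x ⟨hx, τ, hτ⟩
    refine ⟨inv_mem hx, fun g => (ω.theta g x x⁻¹ * τ g)⁻¹, fun h k => ?_⟩
    have hx' := Subgroup.mem_center_iff.1 hx
    have hc : ∀ a : G, x⁻¹ * a * x = a := fun a => by rw [mul_assoc, hx', inv_mul_cancel_left]
    have h1 := ω.theta_gamma h k x x⁻¹
    rw [hτ, hc, hc, mul_inv_cancel, ω.gamma_one_left, mul_one] at h1
    have h2 := congrArg Additive.ofMul h1
    apply Additive.ofMul.injective
    simp only [ofMul_mul, ofMul_div, ofMul_inv] at h2 ⊢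
    linear_combination (norm := abel) h2

theorem gamma_one_char (χ : G →* ℂˣ) (h k : G) :
    ω.gamma 1 h k = (χ : G → ℂˣ) h * χ k / χ (h * k) := by
  rw [map_mul, div_self', ω.gamma_one_left]

variable [Fintype G]

/-- `Γ_0^ω(G)`: the group of central group-like elements of `D^ω(G)`, that is, of the central
units `u` with `Δ(u) = u ⊗ u`. -/
noncomputable def Gamma0 : Subgroup (TwistedDouble ω)ˣ where
  carrier := {u | (u : TwistedDouble ω) ∈ Submonoid.center (TwistedDouble ω) ∧
    comul ω u = (u : TwistedDouble ω) ⊗ₜ[ℂ] (u : TwistedDouble ω)}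
  one_mem' := ⟨one_mem _, by simp [Algebra.TensorProduct.one_def]⟩
  mul_mem' := by
    rintro u v ⟨hu, hu'⟩ ⟨hv, hv'⟩
    refine ⟨mul_mem hu hv, ?_⟩
    rw [Units.val_mul, map_mul, hu', hv', Algebra.TensorProduct.tmul_mul_tmul]
  inv_mem' := by
    rintro u ⟨hu, hu'⟩
    refine ⟨?_, ?_⟩
    · rw [Submonoid.mem_center_iff] at hu ⊢
      intro a
      have h1 := congrArg (fun b => (↑u⁻¹ : TwistedDouble ω) * b * ↑u⁻¹) (hu a)
      simpa [mul_assoc] using h1.symm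
    · have h1 : comul ω ↑u⁻¹ * comul ω ↑u = 1 := by
        rw [← map_mul, Units.inv_mul, map_one]
      have h2 : comul ω ↑u * ((↑u⁻¹ : TwistedDouble ω) ⊗ₜ[ℂ] (↑u⁻¹ : TwistedDouble ω)) = 1 := by
        rw [hu', Algebra.TensorProduct.tmul_mul_tmul, Units.mul_inv,
          Algebra.TensorProduct.one_def]
      exact left_inv_eq_right_inv h1 h2

theorem Gamma0.exists_eq_elt (u : Gamma0 ω) : ∃ x ∈ Z ω, ∃ τ : G → ℂˣ,
    (∀ h k, ω.gamma x h k = τ h * τ k / τ (h * k)) ∧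
      ((u : (TwistedDouble ω)ˣ) : TwistedDouble ω) = elt ω τ x := by
  classical
  have : Nontrivial (TwistedDouble ω) :=
    ⟨⟨e ω 1 1, 0, (basis ω).ne_zero (1, 1)⟩⟩
  obtain ⟨x, τ, hτ, hu⟩ := TwistedDouble.exists_eq_elt ω (Units.ne_zero u.1) u.2.2
  refine ⟨x, ⟨?_, τ, hτ⟩, τ, hτ, hu⟩
  have hc := u.2.1
  rw [hu, Submonoid.mem_center_iff] at hc
  rw [Subgroup.mem_center_iff]
  intro g
  have h1 : e ω g 1 * elt ω τ x = (τ g : ℂ) • e ω g x := by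
    simp only [elt, Finset.mul_sum, mul_smul_comm, e_mul_e]
    rw [Finset.sum_eq_single g]
    · simp
    · intro h _ hh; simp [hh.symm]
    · simp
  have h2 : elt ω τ x * e ω g 1 =
      (τ (x * g * x⁻¹) * ω.theta (x * g * x⁻¹) x 1 : ℂ) • e ω (x * g * x⁻¹) x := by
    simp only [elt, Finset.sum_mul, smul_mul_assoc, e_mul_e]
    rw [Finset.sum_eq_single (x * g * x⁻¹)]
    · rw [if_pos (by group), smul_smul, mul_one]
    · intro h _ hh
      rw [if_neg, smul_zero]
      rintro rfl
      exact hh (by group)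
    · simp
  have h3 := congrArg (fun a => (basis ω).repr a (g, x)) ((h1.symm.trans (hc _)).trans h2)
  by_contra hne
  have hne' : x * g * x⁻¹ ≠ g := fun h => hne (by rw [← mul_inv_eq_iff_eq_mul.1 h])
  simp [e, hne'] at h3

/-- The projection `p : Γ_0^ω(G) → Z_ω(G)` sending `∑_g τ(g) e_g x` to `x`. -/
noncomputable def p : Gamma0 ω →* Z ω :=
  MonoidHom.mk' (fun u => ⟨(Gamma0.exists_eq_elt ω u).choose,
    (Gamma0.exists_eq_elt ω u).choose_spec.1⟩) fun u v => by
      obtain ⟨hx, τ, -, hu⟩ := (Gamma0.exists_eq_elt ω u).choose_spec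
      obtain ⟨-, σ, -, hv⟩ := (Gamma0.exists_eq_elt ω v).choose_spec
      obtain ⟨-, ρ, -, huv⟩ := (Gamma0.exists_eq_elt ω (u * v)).choose_spec
      have h := (congrArg₂ (· * ·) hu hv).trans (elt_mul_elt ω hx.1 _ _ _)
      exact Subtype.ext (elt_injective ω (huv.symm.trans h)).2

/-- The defining property of `p`. -/
theorem p_eq (u : Gamma0 ω) {τ : G → ℂˣ} {x : G}
    (hu : ((u : (TwistedDouble ω)ˣ) : TwistedDouble ω) = elt ω τ x) : (p ω u : G) = x := by
  obtain ⟨-, σ, -, hu'⟩ := (Gamma0.exists_eq_elt ω u).choose_spec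
  exact (elt_injective ω (hu'.symm.trans hu)).2

theorem exists_Gamma0_of_mem {x : G} (hx : x ∈ Subgroup.center G) {τ : G → ℂˣ}
    (hτ : ∀ h k, ω.gamma x h k = τ h * τ k / τ (h * k)) :
    ∃ u : Gamma0 ω, ((u : (TwistedDouble ω)ˣ) : TwistedDouble ω) = elt ω τ x := by
  have hc := elt_mem_center ω hx hτ
  have h1 : elt ω τ x * elt ω (fun g => (ω.theta g x x⁻¹ * τ g)⁻¹) x⁻¹ = 1 := by
    rw [elt_mul_elt ω hx, mul_inv_cancel, ← elt_one]
    congr 1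
    funext g
    rw [← mul_assoc, mul_inv_cancel]; rfl
  exact ⟨⟨⟨_, _, h1, (Submonoid.mem_center_iff.1 hc _).trans h1⟩, hc, comul_elt ω hτ⟩, rfl⟩

/-- The embedding `ι : Ĝ → Γ_0^ω(G)`, `χ ↦ ∑_g χ(g) e_g 1`, of the group of characters of `G`. -/
noncomputable def iota : (G →* ℂˣ) →* Gamma0 ω :=
  have mul_eq : ∀ χ ψ : G →* ℂˣ, elt ω χ 1 * elt ω ψ 1 = elt ω (χ * ψ : G →* ℂˣ) 1 :=
    fun χ ψ => by
      rw [elt_mul_elt ω (one_mem _), mul_one]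
      congr 1
      funext g
      simp
  have one_eq : elt ω (1 : G →* ℂˣ) 1 = 1 := elt_one ω
  MonoidHom.mk' (fun χ => ⟨⟨elt ω χ 1, elt ω (χ⁻¹ : G →* ℂˣ) 1,
      by rw [mul_eq, mul_inv_cancel χ, one_eq], by rw [mul_eq, inv_mul_cancel χ, one_eq]⟩,
      elt_mem_center ω (one_mem _) (gamma_one_char ω χ), comul_elt ω (gamma_one_char ω χ)⟩)
    fun χ ψ => Subtype.ext (Units.ext (mul_eq χ ψ).symm)

theorem coe_iota (χ : G →* ℂˣ) :
    ((iota ω χ : (TwistedDouble ω)ˣ) : TwistedDouble ω) = elt ω χ 1 := rfl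

theorem p_iota (χ : G →* ℂˣ) : p ω (iota ω χ) = 1 := Subtype.ext (p_eq ω _ (coe_iota ω χ))

/-- `Γ_0^ω(G, A) = p⁻¹(A)`. -/
noncomputable def Gamma0On (A : Subgroup G) : Subgroup (Gamma0 ω) :=
  (A.subgroupOf (Z ω)).comap (p ω)

/-- For `A ≤ Z_ω(G)`, the extension `1 → Ĝ → Γ_0^ω(G, A) → A → 1`, with maps `ι` and `p`. -/
noncomputable def extension (A : Subgroup G) (hA : A ≤ Z ω) :
    GroupExtension (G →* ℂˣ) (Gamma0On ω A) A where
  inl := (iota ω).codRestrict (Gamma0On ω A) fun χ => by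
    rw [Gamma0On, Subgroup.mem_comap, p_iota]; exact one_mem _
  rightHom := MonoidHom.mk' (fun u => ⟨(p ω u.1 : G), u.2⟩) fun u v =>
    Subtype.ext (by simp)
  inl_injective χ ψ h := by
    have h1 : elt ω χ 1 = elt ω ψ 1 := congrArg
      (fun u : Gamma0On ω A => (((u : Gamma0 ω) : (TwistedDouble ω)ˣ) : TwistedDouble ω)) h
    exact DFunLike.coe_injective (elt_injective ω h1).1
  range_inl_eq_ker_rightHom := by
    ext u
    constructor
    · rintro ⟨χ, rfl⟩
      exact Subtype.ext (p_eq ω _ (coe_iota ω χ))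
    · intro hu
      obtain ⟨x, -, τ, hτ, hux⟩ := Gamma0.exists_eq_elt ω u.1
      have hx : x = 1 := (p_eq ω u.1 hux).symm.trans (congrArg Subtype.val hu)
      subst hx
      have hmul : ∀ h k, τ (h * k) = τ h * τ k := fun h k => by
        have h1 := hτ h k
        rw [ω.gamma_one_left] at h1
        exact (div_eq_one.1 h1.symm).symm
      exact ⟨MonoidHom.mk' τ hmul, Subtype.ext (Subtype.ext (Units.ext hux.symm))⟩
  rightHom_surjective a := by
    obtain ⟨hx, τ, hτ⟩ := hA a.2
    obtain ⟨u, hu⟩ := exists_Gamma0_of_mem ω hx hτ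
    have hp := p_eq ω u hu
    refine ⟨⟨u, ?_⟩, Subtype.ext hp⟩
    rw [Gamma0On, Subgroup.mem_comap, Subgroup.mem_subgroupOf, hp]
    exact a.2

end CentralGroupLike

end TwistedDouble

/-- A subgroup `A` of `G` is `ω`-admissible if `A ≤ Z_ω(G)` (in particular `A` is central) and
the extension `1 → Ĝ → Γ_0^ω(G, A) → A → 1` splits. -/
def IsAdmissible {G : Type*} [Group G] [Fintype G] (ω : NormalizedCocycle3 G)
    (A : Subgroup G) : Prop :=
  ∃ hA : A ≤ TwistedDouble.Z ω, Nonempty (TwistedDouble.extension ω A hA).Splitting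

/-!
Let `z` be the generator of `A`. It is central, being the only involution of `G`. Suppose that
`τ : G → ℂˣ` satisfies `γ_z(h,k) = τ(h) τ(k) / τ(hk)` and `θ_g(z,z) τ(g)² = 1`. The first
condition says that `z ∈ Z_ω(G)` and that `∑_g τ(g) e_g z` is a central group-like element over
`z`; the second says that its square is `1`, so that it defines a splitting. Thus everything comes down to finding
such a `τ` (`exists_coboundary_sqrt`).

The square roots `a` of `θ_g(z,z)⁻¹`, for `g ∈ G`, form a central extension `E` of `G` by `{1, -1}`
with multiplication `(g, a)(h, b) = (gh, ab / γ_z(g,h))` (`SquareRootExtension`), and `τ` exists as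
soon as `E` splits, i.e. has a sign character that is nontrivial on `(1, -1)`. By transfer
(`exists_hom_of_odd_index`) it suffices to split `E` over a Sylow 2-subgroup `P` of `G`, which also
has a unique involution and therefore is cyclic or generalized quaternion
(`exists_cyclic_or_quaternion`).

Two facts about `E` give the splitting over `P`. Elements of `E` over `z` have square `1`, since
`ω(z,z,z)² = 1`; this settles the cyclic case. Elements `g`, `h` of `E` over the generators of a
quaternion subgroup of order 8 have the same square (`theta_mul_gamma_eq`). If `P` is not cyclic,
let it be generated by `c` and `y` with `ycy⁻¹ = c⁻¹` and `y² = z`, and let `d ∈ ⟨c⟩` have order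
4. Each of `y` and `cy` generates with `d` a quaternion group of order 8, so the lifts of `y`,
`cy` and `d` have equal squares. This says that the defining relations of `P` hold for arbitrary
lifts of `c` and `y`, and these lifts generate a complement of `{1, -1}`.
-/

/-! ### Identities for the cochains `γ_z` and `θ_g(z,z)` -/

namespace NormalizedCocycle3

variable {G : Type*} [Group G] (ω : NormalizedCocycle3 G)

/-- For central `z`, `γ_z` is a 2-cocycle. -/
theorem gamma_cocycle {z : G} (hz : z ∈ Subgroup.center G) (g h k : G) :
    ω.gamma z h k * ω.gamma z g (h * k) = ω.gamma z (g * h) k * ω.gamma z g h := by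
  have hz' := Subgroup.mem_center_iff.1 hz
  have hc : ∀ a : G, z⁻¹ * a * z = a := fun a => by rw [mul_assoc, hz', inv_mul_cancel_left]
  have h1 := congrArg Additive.ofMul (ω.cocycle g h k z)
  have h2 := congrArg Additive.ofMul (ω.cocycle g h z k)
  have h3 := congrArg Additive.ofMul (ω.cocycle g z h k)
  have h4 := congrArg Additive.ofMul (ω.cocycle z g h k)
  apply Additive.ofMul.injective
  simp only [gamma, ofMul_mul, ofMul_div, hc, ← hz'] at *
  linear_combination (norm := abel) h1 - h2 + h3 - h4

/-- For a central involution `z`, `γ_z²` is the coboundary of `g ↦ θ_g(z,z)⁻¹`. Hence `γ_z` is, up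
to the coboundary of a square root of this function, a cocycle with values `±1`. -/
theorem theta_gamma_sq {z : G} (hz : z ∈ Subgroup.center G) (hzz : z * z = 1) (g h : G) :
    ω.theta g z z * ω.theta h z z * ω.gamma z g h ^ 2 = ω.theta (g * h) z z := by
  have hz' := Subgroup.mem_center_iff.1 hz
  have hc : ∀ a : G, z⁻¹ * a * z = a := fun a => by rw [mul_assoc, hz', inv_mul_cancel_left]
  have h1 := ω.theta_gamma g h z z
  rw [hc, hc, hzz, gamma_one_left, mul_one] at h1
  rw [← h1, sq, mul_assoc _ (ω.gamma z g h) (ω.gamma z g h)]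

/-- Independence of the generator of a quaternion group of order 8. Written additively, the
difference of the two sides is `ω` evaluated on an integral 3-cycle of the quaternion group, and this cycle is
the boundary of the ten 4-chains at which the cocycle identity is used. -/
theorem theta_mul_gamma_eq {z g h : G} (hz : z ∈ Subgroup.center G) (hzz : z * z = 1)
    (hg : g * g = z) (hh : h * h = z) (hgh : h * g * h⁻¹ = g⁻¹) :
    ω.theta g z z * ω.gamma z g g = ω.theta h z z * ω.gamma z h h := by
  have hz' := Subgroup.mem_center_iff.1 hz
  have hc : ∀ a : G, z⁻¹ * a * z = a := fun a => by rw [mul_assoc, hz', inv_mul_cancel_left]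
  -- With `k = hg`, the relations are invariant under the cyclic permutation of `g`, `k`, `h`.
  obtain ⟨k, hk⟩ : ∃ k, h * g = k := ⟨_, rfl⟩
  have e1 : g * k = h := by
    rw [← hk, show h * g = g⁻¹ * h by rw [← hgh]; group, mul_inv_cancel_left]
  have e2 : k * h = g := by
    rw [← hk, show h * g = g⁻¹ * h by rw [← hgh]; group, mul_assoc, hh, ← hg, inv_mul_cancel_left]
  have e3 : k * k = z := by
    nth_rw 2 [← hk]
    rw [← mul_assoc, e2, hg]
  have c1 : z * g = g * z := (hz' g).symm
  have c2 : z * h = h * z := (hz' h).symm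
  have c3 : z * k = k * z := (hz' k).symm
  -- Coefficients `±1` at these ten quadruples fill the 3-cycle.
  have h1 := congrArg Additive.ofMul (ω.cocycle g k h z)
  have h2 := congrArg Additive.ofMul (ω.cocycle g k k g)
  have h3 := congrArg Additive.ofMul (ω.cocycle z g k h)
  have h4 := congrArg Additive.ofMul (ω.cocycle z z g k)
  have h5 := congrArg Additive.ofMul (ω.cocycle z h k k)
  have h6 := congrArg Additive.ofMul (ω.cocycle h k k h)
  have h7 := congrArg Additive.ofMul (ω.cocycle k g k k)
  have h8 := congrArg Additive.ofMul (ω.cocycle k h z z)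
  have h9 := congrArg Additive.ofMul (ω.cocycle k k g z)
  have h10 := congrArg Additive.ofMul (ω.cocycle k k h k)
  have e4 : k * g = h * z := by rw [← hk, mul_assoc, hg]
  have e5 : h * k = g * z := by
    rw [← e1, mul_assoc, e3]
  have e6 : g * h = k * z := by
    rw [← e2, mul_assoc, hh]
  have e7 : ∀ a : G, a * z * z = a := fun a => by rw [mul_assoc, hzz, mul_one]
  apply Additive.ofMul.injective
  simp only [theta, gamma, ofMul_mul, ofMul_div, hc, hzz, hg, hh, hk, e1, e2, e3, e4, e5, e6, e7, c1,
    c2, c3, inv_one, one_mul, mul_one, map_one_left, map_one_right] at *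
  linear_combination (norm := abel) h1 - h2 - h3 + h4 - h5 + h6 + h7 - h8 + h9 - h10

end NormalizedCocycle3

/-! ### Finite 2-groups with a unique involution -/

section TwoGroup

variable {P : Type*} [Group P]

theorem mem_zpowers_pow_of_odd (hP : IsPGroup 2 P) (c : P) {s : ℤ} (hs : Odd s) :
    c ∈ Subgroup.zpowers (c ^ s) := by
  obtain ⟨n, hn⟩ := hP c
  obtain ⟨r, hr⟩ := hs
  obtain ⟨u, v, huv⟩ : IsCoprime s ((2 : ℤ) ^ n) :=
    IsCoprime.pow_right ⟨1, -r, by rw [hr]; ring⟩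
  refine ⟨u, ?_⟩
  have hn' : c ^ ((2 : ℤ) ^ n) = 1 := by exact_mod_cast hn
  calc (c ^ s) ^ u = c ^ (u * s + v * 2 ^ n) := by
        rw [zpow_add, mul_comm v, zpow_mul c (2 ^ n), hn', one_zpow, mul_one, mul_comm u, zpow_mul]
    _ = c := by rw [huv, zpow_one]

/-- Iterated squaring of an element outside a subgroup `S` of a 2-group has a last value
outside `S`. -/
theorem exists_pow_notMem_sq_mem (hP : IsPGroup 2 P) (S : Subgroup P) {g : P} (hg : g ∉ S) :
    ∃ k : ℕ, g ^ 2 ^ k ∉ S ∧ (g ^ 2 ^ k) ^ 2 ∈ S := by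
  classical
  have hex : ∃ k : ℕ, g ^ 2 ^ k ∈ S := by
    obtain ⟨n, hn⟩ := hP g
    exact ⟨n, hn ▸ S.one_mem⟩
  obtain ⟨k, hk⟩ : ∃ k, Nat.find hex = k + 1 :=
    Nat.exists_eq_succ_of_ne_zero fun h => hg (by simpa [h] using Nat.find_spec hex)
  refine ⟨k, Nat.find_min hex (by omega), ?_⟩
  rw [← pow_mul, ← pow_succ, ← hk]
  exact Nat.find_spec hex

/-- The subgroups of a cyclic 2-group form a chain. -/
theorem mem_zpowers_or_mem_zpowers_sq (hP : IsPGroup 2 P) {c a b : P}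
    (ha : a ∈ Subgroup.zpowers c) (hb : b ∈ Subgroup.zpowers c) :
    a ∈ Subgroup.zpowers b ∨ b ∈ Subgroup.zpowers (a ^ 2) := by
  have key : ∀ x ∈ Subgroup.zpowers c, ∃ k : ℕ,
      Subgroup.zpowers x = Subgroup.zpowers (c ^ 2 ^ k) := by
    rintro x hx
    obtain ⟨n, hn⟩ := hP c
    have hfin : IsOfFinOrder c := isOfFinOrder_iff_pow_eq_one.2 ⟨2 ^ n, by positivity, hn⟩
    obtain ⟨m, rfl⟩ := (hfin.mem_powers_iff_mem_zpowers).2 hx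
    rcases eq_or_ne m 0 with rfl | hm
    · exact ⟨n, by simp [hn]⟩
    · obtain ⟨k, r, hr, rfl⟩ := Nat.exists_eq_two_pow_mul_odd hm
      refine ⟨k, le_antisymm ?_ ?_⟩
      · rw [Subgroup.zpowers_le]
        exact ⟨r, by simp [pow_mul]⟩
      · rw [Subgroup.zpowers_le]
        have := mem_zpowers_pow_of_odd hP (c ^ 2 ^ k) (s := r) (by exact_mod_cast hr)
        simpa [pow_mul] using this
  obtain ⟨k, hk⟩ := key a ha
  obtain ⟨l, hl⟩ := key b hb
  rcases le_or_gt l k with h | h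
  · left
    have : a ∈ Subgroup.zpowers (c ^ 2 ^ k) := hk ▸ Subgroup.mem_zpowers a
    rw [hl]
    refine (Subgroup.zpowers_le.2 ?_ : Subgroup.zpowers (c ^ 2 ^ k) ≤ _) this
    obtain ⟨d, rfl⟩ := Nat.exists_eq_add_of_le h
    exact ⟨(2 ^ d : ℕ), by simp only [zpow_natCast, ← pow_mul, pow_add]⟩
  · right
    have h1 : b ∈ Subgroup.zpowers (c ^ 2 ^ l) := hl ▸ Subgroup.mem_zpowers b
    have h2 : c ^ 2 ^ k ∈ Subgroup.zpowers a := hk ▸ Subgroup.mem_zpowers _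
    obtain ⟨s, hs⟩ := h2
    refine (Subgroup.zpowers_le.2 ?_ : Subgroup.zpowers (c ^ 2 ^ l) ≤ _) h1
    obtain ⟨d, rfl⟩ := Nat.exists_eq_add_of_lt h
    refine ⟨s * (2 ^ d : ℕ), ?_⟩
    rw [show k + d + 1 = k + (1 + d) by ring, pow_add, pow_mul, ← hs, pow_add, pow_one, pow_mul]
    simp only [← zpow_natCast, ← zpow_mul]
    congr 1; push_cast; ring

/-- A nontrivial normal subgroup of a finite `p`-group contains a nontrivial central element. -/
theorem exists_mem_center_of_normal {p : ℕ} [Fact p.Prime] [Finite P] (hP : IsPGroup p P)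
    (N : Subgroup P) [N.Normal] (hN : N ≠ ⊥) : ∃ x ∈ N, x ≠ 1 ∧ x ∈ Subgroup.center P := by
  have hP' : IsPGroup p (ConjAct P) := hP.of_equiv ConjAct.toConjAct
  have hdvd : p ∣ Nat.card N := by
    have := (Subgroup.nontrivial_iff_ne_bot N).2 hN
    obtain ⟨n, hn, hc⟩ := (hP.to_subgroup N).nontrivial_iff_card.1 this
    exact hc ▸ dvd_pow_self p hn.ne'
  obtain ⟨x, hx, hne⟩ := hP'.exists_fixed_point_of_prime_dvd_card_of_fixed_point (α := N) hdvd
    (a := 1) (fun g => smul_one g)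
  refine ⟨x, x.2, fun h => hne (Subtype.ext h.symm), Subgroup.mem_center_iff.2 fun g => ?_⟩
  have := congrArg Subtype.val (hx (ConjAct.toConjAct g))
  rw [ConjAct.Subgroup.val_conj_smul, ConjAct.smul_def, ConjAct.ofConjAct_toConjAct] at this
  exact mul_inv_eq_iff_eq_mul.1 this

/-- A maximal abelian normal subgroup of a finite `p`-group is its own centralizer. -/
theorem exists_normal_abelian_centralizer_le {p : ℕ} [Fact p.Prime] [Finite P]
    (hP : IsPGroup p P) : ∃ A : Subgroup P, A.Normal ∧ (∀ x ∈ A, ∀ y ∈ A, x * y = y * x) ∧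
      ∀ g, (∀ x ∈ A, g * x = x * g) → g ∈ A := by
  obtain ⟨A, -, hA⟩ := (Set.toFinite {A : Subgroup P | A.Normal ∧ ∀ x ∈ A, ∀ y ∈ A, x * y = y * x}
    ).exists_le_maximal (a := ⊥) ⟨inferInstance, by simp⟩
  obtain ⟨hn, hcomm⟩ := hA.prop
  refine ⟨A, hn, hcomm, fun g hg => ?_⟩
  by_contra hgA
  have hgC : g ∈ Subgroup.centralizer (A : Set P) :=
    Subgroup.mem_centralizer_iff.2 fun x hx => (hg x hx).symm
  set C := Subgroup.centralizer (A : Set P)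
  have : C.Normal := Subgroup.normal_centralizer
  let q := QuotientGroup.mk' A
  have hq : Function.Surjective q := QuotientGroup.mk'_surjective A
  have : (C.map q).Normal := Subgroup.Normal.map this q hq
  obtain ⟨y, ⟨b, hbC, rfl⟩, hb1, hbz⟩ := exists_mem_center_of_normal (hP.to_quotient A) (C.map q)
    fun h => hgA ((QuotientGroup.eq_one_iff g).1
      ((Subgroup.mem_bot).1 (h ▸ Subgroup.mem_map_of_mem q hgC)))
  have hbA : b ∉ A := fun h => hb1 ((QuotientGroup.eq_one_iff b).2 h)
  have hbc : ∀ x ∈ A, x * b = b * x := fun x hx => Subgroup.mem_centralizer_iff.1 hbC x hx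
  -- The preimage `B` of the central subgroup generated by the image of `b`.
  let B := (Subgroup.zpowers (q b)).comap q
  have hBmem : ∀ x ∈ B, ∃ n : ℤ, ∃ a ∈ A, x = b ^ n * a := by
    rintro x ⟨n, hn⟩
    refine ⟨n, (b ^ n)⁻¹ * x, ?_, by group⟩
    rw [← QuotientGroup.eq]
    exact hn
  have hzp : ∀ a ∈ A, ∀ n : ℤ, Commute a (b ^ n) := fun a ha n =>
    (show Commute a b from hbc a ha).zpow_right n
  have hBn : B.Normal := by
    have hz : Subgroup.zpowers (q b) ≤ Subgroup.center _ := Subgroup.zpowers_le.2 hbz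
    have : (Subgroup.zpowers (q b)).Normal := ⟨fun x hx g => by
      rw [(Subgroup.mem_center_iff.1 (hz hx) g), mul_inv_cancel_right]; exact hx⟩
    exact this.comap q
  have hle : A ≤ B := fun x hx => by
    change q x ∈ Subgroup.zpowers (q b)
    have : q x = 1 := (QuotientGroup.eq_one_iff x).2 hx
    rw [this]; exact one_mem _
  have := hA.2 (y := B) ⟨hBn, fun x hx y hy => by
    obtain ⟨n, a, ha, rfl⟩ := hBmem x hx
    obtain ⟨m, a', ha', rfl⟩ := hBmem y hy
    exact ((Commute.zpow_zpow_self b n m).mul_right (hzp a' ha' n).symm).mul_left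
      ((hzp a ha m).mul_right (hcomm a ha a' ha'))⟩ hle
  exact hbA (this (Subgroup.mem_zpowers (q b)))

/-- A commutative 2-group with at most one involution is cyclic: an element outside `⟨c⟩`,
for `c` of maximal order, may be corrected by an element of `⟨c⟩` to an involution. -/
theorem exists_zpowers_eq_of_comm [Finite P] (hP : IsPGroup 2 P) {z : P}
    (huniq : ∀ x : P, x * x = 1 → x = 1 ∨ x = z) (A : Subgroup P) (hz : z ∈ A)
    (hcomm : ∀ x ∈ A, ∀ y ∈ A, x * y = y * x) : ∃ c, A = Subgroup.zpowers c := by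
  obtain ⟨c, hcA, hmax⟩ := (Set.toFinite (A : Set P)).exists_maximalFor orderOf _ ⟨z, hz⟩
  refine ⟨c, le_antisymm (fun b' hb' => ?_) (Subgroup.zpowers_le.2 hcA)⟩
  by_contra hbc'
  obtain ⟨k, hbc, s, hs⟩ := exists_pow_notMem_sq_mem hP _ hbc'
  have hb : b' ^ 2 ^ k ∈ A := pow_mem hb' _
  set b := b' ^ 2 ^ k
  change c ^ s = b ^ 2 at hs
  rcases Int.even_or_odd' s with ⟨t, rfl | rfl⟩
  · have hsq : (b * (c ^ t)⁻¹) * (b * (c ^ t)⁻¹) = 1 := by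
      have hcb : Commute b (c ^ t)⁻¹ := hcomm b hb _ (inv_mem (zpow_mem hcA t))
      rw [← sq, hcb.mul_pow, ← hs, two_mul, zpow_add]
      group
    have hmem : b * (c ^ t)⁻¹ ∈ Subgroup.zpowers c := by
      rcases huniq _ hsq with h | h
      · rw [h]; exact one_mem _
      · rw [h]
        have hc1 : c ∉ (⊥ : Subgroup P) := by
          intro hc
          rw [Subgroup.mem_bot] at hc
          apply hbc
          have h1 : orderOf b ≤ orderOf c := hmax hb (by
            rw [hc, orderOf_one]; exact orderOf_pos b)
          rw [hc, orderOf_one] at h1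
          rw [orderOf_eq_one_iff.1 (le_antisymm h1 (orderOf_pos b))]
          exact one_mem _
        obtain ⟨l, hl, hl'⟩ := exists_pow_notMem_sq_mem hP _ hc1
        rw [Subgroup.mem_bot] at hl hl'
        rw [sq] at hl'
        rw [← (huniq _ hl').resolve_left hl]
        exact pow_mem (Subgroup.mem_zpowers c) _
    apply hbc
    have := mul_mem hmem (zpow_mem (Subgroup.mem_zpowers c) t)
    rwa [inv_mul_cancel_right] at this
  · have hcb : c ∈ Subgroup.zpowers b := by
      have h1 := mem_zpowers_pow_of_odd hP c (s := 2 * t + 1) ⟨t, rfl⟩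
      rw [hs] at h1
      exact (Subgroup.zpowers_le.2 (pow_mem (Subgroup.mem_zpowers b) 2)) h1
    have hlt : Subgroup.zpowers c ≤ Subgroup.zpowers b := Subgroup.zpowers_le.2 hcb
    apply hbc
    have hd : orderOf c ∣ orderOf b := orderOf_dvd_of_mem_zpowers hcb
    have h2 : orderOf b ≤ orderOf c := hmax hb (Nat.le_of_dvd (orderOf_pos b) hd)
    rw [Subgroup.eq_of_le_of_card_ge hlt (by rwa [Nat.card_zpowers, Nat.card_zpowers])]
    exact Subgroup.mem_zpowers b

/-- Let `g` normalize a cyclic subgroup `⟨c⟩` of a 2-group and not centralize it. If `g² ∈ ⟨c⟩`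
and the coset `g⟨c⟩` contains no square root of `1`, then `g` inverts `c`: since `g²` is not of the
form `a · gag⁻¹` with `a ∈ ⟨c⟩`, the element `c · gcg⁻¹` is an even power of `g²`. -/
theorem conj_eq_inv_of_sq_mem (hP : IsPGroup 2 P) {c g : P}
    (hconj : g * c * g⁻¹ ∈ Subgroup.zpowers c) (hg2 : g ^ 2 ∈ Subgroup.zpowers c)
    (hcent : g * c ≠ c * g) (hinv : ∀ a ∈ Subgroup.zpowers c, (a * g) * (a * g) ≠ 1) :
    g * c * g⁻¹ = c⁻¹ := by
  have hcomm : ∀ a ∈ Subgroup.zpowers c, ∀ b ∈ Subgroup.zpowers c, Commute a b := by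
    rintro _ ⟨i, rfl⟩ _ ⟨j, rfl⟩
    exact Commute.zpow_zpow_self c i j
  have hgg : Commute g (g ^ 2) := (Commute.refl g).pow_right 2
  have hx : c * (g * c * g⁻¹) ∈ Subgroup.zpowers c := mul_mem (Subgroup.mem_zpowers c) hconj
  rcases mem_zpowers_or_mem_zpowers_sq hP hg2 hx with ⟨n, hn⟩ | ⟨n, hn⟩
  · exfalso
    have hcn : (c ^ n)⁻¹ ∈ Subgroup.zpowers c := inv_mem (zpow_mem (Subgroup.mem_zpowers c) n)
    refine hinv _ hcn ?_
    have hn' : c ^ n * (g * c ^ n * g⁻¹) = g ^ 2 := by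
      rw [← hn]
      change _ = (c * (g * c * g⁻¹)) ^ n
      rw [(hcomm c (Subgroup.mem_zpowers c) _ hconj).mul_zpow, conj_zpow]
    have h1 : (c ^ n)⁻¹ * g * ((c ^ n)⁻¹ * g) = (c ^ n)⁻¹ * (g * c ^ n * g⁻¹)⁻¹ * g ^ 2 := by
      rw [sq]; group
    have h2 : (g * c ^ n * g⁻¹) ∈ Subgroup.zpowers c := by
      rw [← conj_zpow]; exact zpow_mem hconj n
    rw [h1, ← hn', ← mul_inv_rev, (hcomm _ h2 _ (zpow_mem (Subgroup.mem_zpowers c) n)).eq,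
      inv_mul_cancel]
  · change ((g ^ 2) ^ 2) ^ n = c * (g * c * g⁻¹) at hn
    obtain ⟨s, hs⟩ := hg2
    change c ^ s = g ^ 2 at hs
    have hodd : ¬ Odd s := by
      intro hodd
      have h1 := mem_zpowers_pow_of_odd hP c hodd
      rw [hs] at h1
      obtain ⟨m, hm⟩ := h1
      apply hcent
      change (g ^ 2) ^ m = c at hm
      rw [← hm]
      exact (hgg.zpow_right m).eq
    obtain ⟨l, rfl⟩ := even_iff_two_dvd.1 (Int.not_odd_iff_even.1 hodd)
    -- `v` is an odd power of `c` with `v · gvg⁻¹ = 1`.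
    have hv : c⁻¹ * (g ^ 2) ^ n = c ^ (2 * (l * n) - 1) := by
      rw [← hs, ← zpow_mul, ← zpow_neg_one, ← zpow_add]; congr 1; ring
    have hgn : Commute g ((g ^ 2) ^ n) := hgg.zpow_right n
    have hvinv : g * (c⁻¹ * (g ^ 2) ^ n) * g⁻¹ = (c⁻¹ * (g ^ 2) ^ n)⁻¹ := by
      have h1 : g * (c⁻¹ * (g ^ 2) ^ n) * g⁻¹ = (g * c * g⁻¹)⁻¹ * (g ^ 2) ^ n := by
        rw [show g * (c⁻¹ * (g ^ 2) ^ n) * g⁻¹ = g * c⁻¹ * ((g ^ 2) ^ n * g⁻¹) by group,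
          ← hgn.inv_left.eq]
        group
      have h2 : g * c * g⁻¹ = c⁻¹ * ((g ^ 2) ^ n * (g ^ 2) ^ n) := by
        rw [← zpow_add, ← two_mul, zpow_mul]
        rw [eq_inv_mul_iff_mul_eq, ← hn]
        norm_cast
      have hfc : Commute c ((g ^ 2) ^ n) :=
        hcomm _ (Subgroup.mem_zpowers c) _ (zpow_mem (hs ▸ ⟨2 * l, rfl⟩) n)
      rw [h1, h2, mul_inv_rev, mul_inv_rev, mul_inv_rev, inv_inv, mul_assoc, hfc.eq]
      group
    obtain ⟨m, hm⟩ := mem_zpowers_pow_of_odd hP c (s := 2 * (l * n) - 1) ⟨l * n - 1, by ring⟩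
    change (c ^ (2 * (l * n) - 1)) ^ m = c at hm
    rw [← hv] at hm
    calc g * c * g⁻¹ = g * (c⁻¹ * (g ^ 2) ^ n) ^ m * g⁻¹ := by rw [hm]
      _ = c⁻¹ := by rw [← conj_zpow, hvinv, inv_zpow, hm]

/-- A finite 2-group with a unique involution `z` is cyclic or generalized quaternion. In the
second case `⟨c⟩` is a cyclic subgroup of index 2, and `d` is an element of order 4 in it. The group
`⟨c⟩` is a maximal abelian normal subgroup: elements outside it invert it, so that the product of
two of them centralizes it and hence lies in it. -/
theorem exists_cyclic_or_quaternion [Finite P] (hP : IsPGroup 2 P) {z : P}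
    (hz : z ≠ 1) (hzz : z * z = 1) (huniq : ∀ x : P, x * x = 1 → x = 1 ∨ x = z) :
    (∃ c : P, ∀ x, x ∈ Subgroup.zpowers c) ∨
    ∃ c y : P, ∃ d ∈ Subgroup.zpowers c, d * d = z ∧ y * y = z ∧ y * c * y⁻¹ = c⁻¹ ∧
      y ∉ Subgroup.zpowers c ∧ ∀ x, x ∈ Subgroup.zpowers c ∨ y * x ∈ Subgroup.zpowers c := by
  obtain ⟨A, hn, hcomm, hself⟩ := exists_normal_abelian_centralizer_le hP
  have hzc : ∀ x : P, z * x = x * z := fun x => by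
    have h1 : (x * z * x⁻¹) * (x * z * x⁻¹) = 1 := by
      rw [show (x * z * x⁻¹) * (x * z * x⁻¹) = x * (z * z) * x⁻¹ by group, hzz]; group
    rcases huniq _ h1 with h | h
    · exact absurd (conj_eq_one_iff.1 h) hz
    · exact (mul_inv_eq_iff_eq_mul.1 h).symm
  have hzA : z ∈ A := hself z fun x _ => hzc x
  obtain ⟨c, rfl⟩ := exists_zpowers_eq_of_comm hP huniq A hzA hcomm
  have hc := Subgroup.mem_zpowers c
  have hcent : ∀ g, g ∉ Subgroup.zpowers c → g * c ≠ c * g := fun g hg h =>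
    hg (hself g (by rintro _ ⟨n, rfl⟩; exact (show Commute g c from h).zpow_right n))
  have hinvol : ∀ x : P, x * x = 1 → x ∈ Subgroup.zpowers c := fun x hx => by
    rcases huniq x hx with rfl | rfl
    exacts [one_mem _, hzA]
  have hinv : ∀ g, g ∉ Subgroup.zpowers c → g ^ 2 ∈ Subgroup.zpowers c → g * c * g⁻¹ = c⁻¹ :=
    fun g hg hg2 => conj_eq_inv_of_sq_mem hP (hn.conj_mem c hc g) hg2 (hcent g hg)
      fun a ha h => hg ((Subgroup.mul_mem_cancel_left _ ha).1 (hinvol _ h))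
  by_cases hall : ∀ x, x ∈ Subgroup.zpowers c
  · exact Or.inl ⟨c, hall⟩
  right
  push Not at hall
  obtain ⟨y', hy'⟩ := hall
  obtain ⟨k, hk, hk2⟩ := exists_pow_notMem_sq_mem hP _ hy'
  -- If `z` were an odd power of `c`, then `c ∈ ⟨z⟩` would be central.
  obtain ⟨d, hd, hdz⟩ : ∃ d ∈ Subgroup.zpowers c, d * d = z := by
    obtain ⟨s, hs⟩ := hzA
    change c ^ s = z at hs
    rcases Int.even_or_odd' s with ⟨t, rfl | rfl⟩
    · exact ⟨c ^ t, ⟨t, rfl⟩, by rw [← hs, ← zpow_add, two_mul]⟩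
    · exfalso
      obtain ⟨m, hm⟩ := mem_zpowers_pow_of_odd hP c (s := 2 * t + 1) ⟨t, rfl⟩
      rw [hs] at hm
      change z ^ m = c at hm
      apply hcent _ hk
      rw [← hm]
      exact (show Commute _ z from (hzc _).symm).zpow_right m
  have hdd : d ≠ d⁻¹ := fun h => hz (by rw [← hdz]; nth_rw 2 [h]; exact mul_inv_cancel d)
  -- No element acts on `⟨c⟩` as a square root of inversion, since it would fix or invert `d`.
  have hsq : ∀ g, g ∉ Subgroup.zpowers c → g ^ 2 ∈ Subgroup.zpowers c := by
    intro g hg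
    by_contra hg2
    obtain ⟨l, hl, hl2⟩ := exists_pow_notMem_sq_mem hP _ hg2
    obtain ⟨q, hq⟩ : ∃ q, q ^ 2 = (g ^ 2) ^ 2 ^ l :=
      ⟨g ^ 2 ^ l, by rw [← pow_mul, ← pow_mul, mul_comm]⟩
    have h1 := hinv _ hl hl2
    rw [← hq] at h1
    have h2 : q ^ 2 * d * (q ^ 2)⁻¹ = d⁻¹ := by
      obtain ⟨n, rfl⟩ := hd
      change q ^ 2 * c ^ n * (q ^ 2)⁻¹ = (c ^ n)⁻¹
      rw [← conj_zpow, h1, inv_zpow]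
    have h3 : q * d * q⁻¹ = d ∨ q * d * q⁻¹ = d⁻¹ := by
      have hm : q * d * q⁻¹ ∈ Subgroup.zpowers c := hn.conj_mem d hd q
      have h4 : (q * d * q⁻¹ * d⁻¹) * (q * d * q⁻¹ * d⁻¹) = 1 := by
        have h5 : Commute (q * d * q⁻¹) d⁻¹ := hcomm _ hm _ (inv_mem hd)
        rw [← sq, h5.mul_pow, sq, show q * d * q⁻¹ * (q * d * q⁻¹) = q * (d * d) * q⁻¹ by group,
          hdz, ← hzc, mul_inv_cancel_right, inv_pow, sq, hdz, mul_inv_cancel]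
      rcases huniq _ h4 with h | h
      · exact Or.inl (mul_inv_eq_one.1 h)
      · right
        rw [mul_inv_eq_iff_eq_mul.1 h, eq_inv_iff_mul_eq_one, mul_assoc, hdz, hzz]
    apply hdd
    rw [← h2, sq, show q * q * d * (q * q)⁻¹ = q * (q * d * q⁻¹) * q⁻¹ by group]
    rcases h3 with h | h
    · rw [h, h]
    · rw [h, ← conj_inv, h, inv_inv]
  have hy := hinv y' hy' (hsq y' hy')
  refine ⟨c, y', d, hd, hdz, ?_, hy, hy', fun x => ?_⟩
  · obtain ⟨n, hn'⟩ := hsq y' hy'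
    change c ^ n = y' ^ 2 at hn'
    have h1 : y' ^ 2 = (y' ^ 2)⁻¹ := by
      conv_lhs => rw [show y' ^ 2 = y' * y' ^ 2 * y'⁻¹ by group, ← hn', ← conj_zpow, hy, inv_zpow]
      rw [hn']
    rcases huniq (y' ^ 2) (by nth_rw 2 [h1]; exact mul_inv_cancel _) with h | h
    · exact absurd (hinvol y' (by rw [← sq, h])) hy'
    · rw [← sq, h]
  · by_contra! hx
    have h1 := hinv x hx.1 (hsq x hx.1)
    apply hcent _ hx.2
    rw [← mul_inv_eq_iff_eq_mul, show y' * x * c * (y' * x)⁻¹ = y' * (x * c * x⁻¹) * y'⁻¹ by group,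
      h1, ← conj_inv, hy, inv_inv]

end TwoGroup

/-! ### Splitting central extensions by a group of order 2 -/

section CentralExtension

variable {E : Type*} [Group E]

/-- A complement `H` of `{1, ε}` is the kernel of a sign character that is nontrivial on `ε`. -/
theorem exists_hom_of_complement {ε : E} (H : Subgroup E) (hε : ε ∉ H)
    (hH : ∀ e, ε * e ∈ H ∨ e ∈ H) : ∃ φ : E →* ℤˣ, φ ε = -1 := by
  classical
  have h2 : H.index = 2 := Subgroup.index_eq_two_iff_exists_notMem_and'.2 ⟨ε, hε, hH⟩
  refine ⟨MonoidHom.mk' (fun e => if e ∈ H then 1 else -1) fun a b => ?_, by simp [hε]⟩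
  have := Subgroup.mul_mem_iff_of_index_two h2 (a := a) (b := b)
  by_cases ha : a ∈ H <;> by_cases hb : b ∈ H <;> simp_all

/-- The subgroup generated by a subgroup `C` together with an element `y` that inverts `C` and
whose square lies in `C`, described as the union of `C` and `y⁻¹C`. -/
def Subgroup.adjoinInverting (C : Subgroup E) (y : E) (hy : y * y ∈ C)
    (hconj : ∀ x ∈ C, y * x * y⁻¹ = x⁻¹) : Subgroup E where
  carrier := {x | x ∈ C ∨ y * x ∈ C}
  one_mem' := Or.inl C.one_mem
  mul_mem' := by
    rintro a b (ha | ha) (hb | hb)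
    · exact Or.inl (mul_mem ha hb)
    · right
      rw [show y * (a * b) = (y * a * y⁻¹) * (y * b) by group, hconj a ha]
      exact mul_mem (inv_mem ha) hb
    · right
      rw [← mul_assoc]
      exact mul_mem ha hb
    · left
      have h1 : y⁻¹ * (y * a) * y = (y * a)⁻¹ := by
        have h := hconj _ (inv_mem ha)
        rw [inv_inv] at h
        generalize y * a = p at h
        nth_rw 1 [← h]
        group
      rw [show a * b = (y⁻¹ * (y * a) * y) * (y * y)⁻¹ * (y * b) by group, h1]
      exact mul_mem (mul_mem (inv_mem ha) (inv_mem hy)) hb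
  inv_mem' := by
    rintro a (ha | ha)
    · exact Or.inl (inv_mem ha)
    · right
      rw [show y * a⁻¹ = (y * (y * a)⁻¹ * y⁻¹) * (y * y) by group, hconj _ (inv_mem ha)]
      exact mul_mem (inv_mem (inv_mem ha)) hy

variable {P : Type*} [Group P]

/-- A central extension `E` of a finite 2-group `P` with a unique involution `z` by a group
`{1, ε}` of order 2 splits, provided that lifts of `z` are involutions and that any two elements
lying over the generators of a quaternion subgroup of order 8 have equal squares. -/
theorem exists_hom_of_isPGroup_two [Finite P] (hP : IsPGroup 2 P) {z : P} (hz : z ≠ 1)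
    (hzz : z * z = 1) (huniq : ∀ x : P, x * x = 1 → x = 1 ∨ x = z) (π : E →* P)
    (hπ : Function.Surjective π) {ε : E} (hε : ε ≠ 1) (hπε : π ε = 1)
    (hker : ∀ e, π e = 1 → e = 1 ∨ e = ε) (hsq : ∀ u, π u = z → u * u = 1)
    (hquat : ∀ g h, π g * π g = z → π h * π h = z → π h * π g * (π h)⁻¹ = (π g)⁻¹ →
      g * g = h * h) : ∃ φ : E →* ℤˣ, φ ε = -1 := by
  have hlift : ∀ x y, π x = π y → x = y ∨ ε * x = y := fun x y hxy => by
    have h1 : π (y * x⁻¹) = 1 := by rw [map_mul, map_inv, hxy, mul_inv_cancel]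
    rcases hker _ h1 with h | h
    · exact Or.inl (mul_inv_eq_one.1 h).symm
    · exact Or.inr (mul_inv_eq_iff_eq_mul.1 h).symm
  -- If `z ∈ ⟨π c⟩`, then `⟨c⟩` meets the kernel trivially: half of the order of `π c` gives a power
  -- of `c` over `z`, and its square is `1`.
  have hnot : ∀ c : E, (∃ n : ℤ, π c ^ n = z) → ε ∉ Subgroup.zpowers c := by
    rintro c ⟨n, hn⟩ ⟨m, hm⟩
    change c ^ m = ε at hm
    have hc0 : π c ≠ 1 := fun h => hz (by rw [← hn, h, one_zpow])
    obtain ⟨k, hk⟩ := hP.dvd_orderOf hc0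
    have hfin : 0 < orderOf (π c) := orderOf_pos _
    have hck : π c ^ k = z := by
      refine (huniq _ ?_).resolve_left (pow_ne_one_of_lt_orderOf (by omega) (by omega))
      rw [← pow_add, ← two_mul, ← hk, pow_orderOf_eq_one]
    have h1 : c ^ orderOf (π c) = 1 := by
      rw [hk, two_mul, pow_add]
      exact hsq _ (by rw [map_pow, hck])
    have h2 : (orderOf (π c) : ℤ) ∣ m := by
      rw [orderOf_dvd_iff_zpow_eq_one, ← map_zpow, hm, hπε]
    obtain ⟨r, rfl⟩ := h2
    rw [zpow_mul, zpow_natCast, h1, one_zpow] at hm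
    exact hε hm.symm
  have hpow : ∀ (c : E) (e : E), π e ∈ Subgroup.zpowers (π c) →
      ε * e ∈ Subgroup.zpowers c ∨ e ∈ Subgroup.zpowers c := by
    rintro c e ⟨n, hn⟩
    change π c ^ n = π e at hn
    rw [← map_zpow] at hn
    rcases hlift _ _ hn.symm with h | h
    · exact Or.inr ⟨n, h.symm⟩
    · exact Or.inl ⟨n, h.symm⟩
  rcases exists_cyclic_or_quaternion hP hz hzz huniq with
    ⟨c, hc⟩ | ⟨c, y, d, hd, hdz, hyy, hyc, hynot, hall⟩
  · obtain ⟨c, rfl⟩ := hπ c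
    exact exists_hom_of_complement _ (hnot c (hc z)) fun e => hpow c e (hc _)
  · obtain ⟨c, rfl⟩ := hπ c
    obtain ⟨y, rfl⟩ := hπ y
    obtain ⟨j, rfl⟩ := hd
    change π c ^ j * π c ^ j = z at hdz
    have hcj : π y * π c ^ j * (π y)⁻¹ = (π c ^ j)⁻¹ := by rw [← conj_zpow, hyc, inv_zpow]
    -- Both `y` and `cy` generate a quaternion group together with `d = c ^ j`, so the two have the
    -- same square; this is the relation `ycy⁻¹ = c⁻¹` upstairs.
    have h1 : c ^ j * c ^ j = y * y :=
      hquat _ _ (by rw [map_zpow, hdz]) hyy (by rw [map_zpow, hcj])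
    have hcy : π y * π c = (π c)⁻¹ * π y := mul_inv_eq_iff_eq_mul.1 hyc
    have h2 : c ^ j * c ^ j = c * y * (c * y) := by
      refine hquat _ _ (by rw [map_zpow, hdz]) ?_ ?_
      · rw [map_mul, mul_assoc, ← mul_assoc (π y), hcy, mul_assoc, mul_inv_cancel_left, hyy]
      · rw [map_zpow, map_mul, show π c * π y * π c ^ j * (π c * π y)⁻¹ =
          π c * (π y * π c ^ j * (π y)⁻¹) * (π c)⁻¹ by group, hcj]
        group
    have h3 : y * c * y⁻¹ = c⁻¹ := by
      rw [h1] at h2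
      have h4 : y = c * y * c := mul_right_cancel (b := y) (by rw [h2]; group)
      rw [mul_inv_eq_iff_eq_mul, eq_inv_mul_iff_mul_eq, ← mul_assoc, ← h4]
    have hconj : ∀ x ∈ Subgroup.zpowers c, y * x * y⁻¹ = x⁻¹ := by
      rintro _ ⟨n, rfl⟩
      change y * c ^ n * y⁻¹ = (c ^ n)⁻¹
      rw [← conj_zpow, h3, inv_zpow]
    have hyyC : y * y ∈ Subgroup.zpowers c := by
      rw [← h1, ← zpow_add]; exact ⟨_, rfl⟩
    refine exists_hom_of_complement (Subgroup.adjoinInverting _ y hyyC hconj) ?_ fun e => ?_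
    · rintro (h | ⟨n, hn⟩)
      · exact hnot c ⟨j + j, by rw [zpow_add, hdz]⟩ h
      · apply hynot
        change c ^ n = y * ε at hn
        refine ⟨n, ?_⟩
        change π c ^ n = π y
        rw [← map_zpow, hn, map_mul, hπε, mul_one]
    · have hεc : y * ε = ε * y := by
        have h5 : π (y * ε * y⁻¹) = 1 := by simp [hπε]
        rcases hker _ h5 with h | h
        · exact absurd (conj_eq_one_iff.1 h) hε
        · exact mul_inv_eq_iff_eq_mul.1 h
      rcases hall (π e) with h | h
      · exact (hpow c e h).imp Or.inl Or.inl
      · rw [← map_mul] at h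
        refine (hpow c _ h).imp (fun h => Or.inr ?_) Or.inr
        rwa [← mul_assoc, hεc, mul_assoc]

variable {G : Type*} [Group G]

/-- The transfer to a subgroup of odd index extends a sign character that is nontrivial on a
central involution. -/
theorem exists_hom_of_odd_index {ε : E} (hcent : ε ∈ Subgroup.center E)
    (H : Subgroup E) (hodd : Odd H.index) (hεH : ε ∈ H) (φ : H →* ℤˣ) (hφ : φ ⟨ε, hεH⟩ = -1) :
    ∃ ψ : E →* ℤˣ, ψ ε = -1 := by
  have : H.FiniteIndex := ⟨fun h => by rw [h] at hodd; exact absurd hodd (by decide)⟩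
  refine ⟨MonoidHom.transfer φ, ?_⟩
  rw [MonoidHom.transfer_eq_pow φ ε fun k g₀ _ => by
    rw [mul_assoc, ← Subgroup.mem_center_iff.1 (pow_mem hcent k) g₀, inv_mul_cancel_left]]
  have h1 : (⟨ε ^ H.index, MonoidHom.transfer_eq_pow_aux ε fun k g₀ _ => by
    rw [mul_assoc, ← Subgroup.mem_center_iff.1 (pow_mem hcent k) g₀, inv_mul_cancel_left]⟩ : H) =
      (⟨ε, hεH⟩ : H) ^ H.index := rfl
  rw [h1, map_pow, hφ, hodd.neg_one_pow]

/-- The splitting criterion of `exists_hom_of_isPGroup_two` for an arbitrary finite group with a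
unique involution. -/
theorem exists_hom_of_unique_involution [Finite G] {z : G} (hz : z ≠ 1)
    (hzz : z * z = 1) (huniq : ∀ x : G, x * x = 1 → x = 1 ∨ x = z) (π : E →* G)
    (hπ : Function.Surjective π) {ε : E} (hε : ε ≠ 1) (hπε : π ε = 1)
    (hker : ∀ e, π e = 1 → e = 1 ∨ e = ε) (hsq : ∀ u, π u = z → u * u = 1)
    (hquat : ∀ g h, π g * π g = z → π h * π h = z → π h * π g * (π h)⁻¹ = (π g)⁻¹ →
      g * g = h * h) : ∃ φ : E →* ℤˣ, φ ε = -1 := by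
  have hzP : IsPGroup 2 (Subgroup.zpowers z) := by
    refine IsPGroup.of_card (n := 1) ?_
    rw [Nat.card_zpowers, orderOf_eq_prime (by rw [sq, hzz]) hz, pow_one]
  obtain ⟨S, hS⟩ := hzP.exists_le_sylow
  have hzS : z ∈ (S : Subgroup G) := hS (Subgroup.mem_zpowers z)
  let H : Subgroup E := (S : Subgroup G).comap π
  have hεH : ε ∈ H := by
    change π ε ∈ (S : Subgroup G); rw [hπε]; exact one_mem _
  let πS : H →* (S : Subgroup G) := π.subgroupComap S
  have hπS : ∀ e : H, (πS e : G) = π e := fun _ => rfl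
  obtain ⟨φ, hφ⟩ := exists_hom_of_isPGroup_two (z := (⟨z, hzS⟩ : (S : Subgroup G))) S.isPGroup'
    (fun h => hz (congrArg Subtype.val h)) (Subtype.ext hzz)
    (fun x hx => (huniq x (congrArg Subtype.val hx)).imp Subtype.ext Subtype.ext) πS
    (fun x => by
      obtain ⟨e, he⟩ := hπ x
      exact ⟨⟨e, by change π e ∈ (S : Subgroup G); rw [he]; exact x.2⟩, Subtype.ext he⟩)
    (ε := ⟨ε, hεH⟩) (fun h => hε (congrArg Subtype.val h)) (Subtype.ext hπε)
    (fun e he => (hker e (congrArg Subtype.val he)).imp Subtype.ext Subtype.ext)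
    (fun u hu => Subtype.ext (hsq u (congrArg Subtype.val hu)))
    (fun g h h1 h2 h3 => Subtype.ext (hquat g h (congrArg Subtype.val h1)
      (congrArg Subtype.val h2) (congrArg Subtype.val h3)))
  refine exists_hom_of_odd_index (Subgroup.mem_center_iff.2 fun g => ?_) H ?_ hεH φ hφ
  · rcases hker (g * ε * g⁻¹) (by simp [hπε]) with h | h
    · exact absurd (conj_eq_one_iff.1 h) hε
    · exact mul_inv_eq_iff_eq_mul.1 h
  · rw [Subgroup.index_comap_of_surjective _ hπ, ← Nat.not_even_iff_odd, even_iff_two_dvd]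
    exact S.not_dvd_index

end CentralExtension

/-! ### The extension of square roots of `θ_g(z,z)⁻¹` -/

/-- For a central involution `z`, the elements over `g` are the square roots of `θ_g(z,z)⁻¹`.
With the multiplication `(g, a)(h, b) = (gh, ab / γ_z(g,h))` they form a central extension of `G`
by `{1, -1}`. The involution property is a parameter because the group structure depends on it. -/
@[ext]
structure SquareRootExtension {G : Type*} [Group G] (ω : NormalizedCocycle3 G) {z : G}
    (_hz : z ∈ Subgroup.center G) (_hzz : z * z = 1) where
  pt : G
  val : ℂˣ
  sq_mul_theta : val ^ 2 * ω.theta pt z z = 1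

namespace SquareRootExtension

variable {G : Type*} [Group G] {ω : NormalizedCocycle3 G} {z : G} {hz : z ∈ Subgroup.center G}
  {hzz : z * z = 1}

instance : Mul (SquareRootExtension ω hz hzz) :=
  ⟨fun x y => ⟨x.pt * y.pt, x.val * y.val / ω.gamma z x.pt y.pt, by
    rw [← ω.theta_gamma_sq hz hzz, div_pow, mul_pow, div_mul_eq_mul_div, div_eq_one,
      ← mul_assoc (x.val ^ 2 * y.val ^ 2), mul_mul_mul_comm (x.val ^ 2), x.sq_mul_theta,
      y.sq_mul_theta, one_mul, one_mul]⟩⟩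

instance : One (SquareRootExtension ω hz hzz) := ⟨⟨1, 1, by simp⟩⟩

instance : Inv (SquareRootExtension ω hz hzz) :=
  ⟨fun x => ⟨x.pt⁻¹, ω.gamma z x.pt⁻¹ x.pt / x.val, by
    have h := ω.theta_gamma_sq hz hzz x.pt⁻¹ x.pt
    rw [inv_mul_cancel, ω.theta_one_left, ← x.sq_mul_theta, mul_right_comm, mul_left_inj] at h
    rw [div_pow, div_mul_eq_mul_div, mul_comm, h, div_self']⟩⟩

@[simp] theorem mul_pt (x y : SquareRootExtension ω hz hzz) : (x * y).pt = x.pt * y.pt := rfl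

@[simp] theorem mul_val (x y : SquareRootExtension ω hz hzz) :
    (x * y).val = x.val * y.val / ω.gamma z x.pt y.pt := rfl

@[simp] theorem one_pt : (1 : SquareRootExtension ω hz hzz).pt = 1 := rfl

@[simp] theorem one_val : (1 : SquareRootExtension ω hz hzz).val = 1 := rfl

@[simp] theorem inv_pt (x : SquareRootExtension ω hz hzz) : x⁻¹.pt = x.pt⁻¹ := rfl

@[simp] theorem inv_val (x : SquareRootExtension ω hz hzz) :
    x⁻¹.val = ω.gamma z x.pt⁻¹ x.pt / x.val := rfl

instance : Group (SquareRootExtension ω hz hzz) :=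
  Group.ofLeftAxioms
    (fun x y w => by
      refine SquareRootExtension.ext (mul_assoc _ _ _) ?_
      simp only [mul_val, mul_pt]
      have h := congrArg Additive.ofMul (ω.gamma_cocycle hz x.pt y.pt w.pt)
      apply Additive.ofMul.injective
      simp only [ofMul_mul, ofMul_div] at h ⊢
      linear_combination (norm := abel) h)
    (fun x => SquareRootExtension.ext (one_mul _) (by simp))
    (fun x => SquareRootExtension.ext (inv_mul_cancel _) (by simp))

/-- The projection to `G`. -/
def proj : SquareRootExtension ω hz hzz →* G := MonoidHom.mk' pt fun _ _ => rfl

theorem proj_surjective : Function.Surjective (proj (ω := ω) (hz := hz) (hzz := hzz)) := fun g => by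
  obtain ⟨a, ha⟩ := IsAlgClosed.exists_pow_nat_eq ((ω.theta g z z)⁻¹ : ℂˣ).val two_pos
  have ha0 : a ≠ 0 := fun h => by
    rw [h, zero_pow two_ne_zero] at ha
    exact (Units.ne_zero _) ha.symm
  refine ⟨⟨g, Units.mk0 a ha0, ?_⟩, rfl⟩
  rw [← eq_inv_iff_mul_eq_one]
  exact Units.ext ha

/-- The generator `(1, -1)` of the kernel of the projection. -/
def negOne : SquareRootExtension ω hz hzz := ⟨1, -1, by simp⟩

theorem negOne_mul_val (x : SquareRootExtension ω hz hzz) : (negOne * x).val = -x.val := by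
  simp [negOne]

theorem eq_or_eq_negOne_mul {x y : SquareRootExtension ω hz hzz} (h : x.pt = y.pt) :
    x = y ∨ x = negOne * y := by
  have h1 : x.val ^ 2 = y.val ^ 2 := mul_right_cancel (x.sq_mul_theta.trans (h ▸ y.sq_mul_theta.symm))
  have h2 : (x.val : ℂ) ^ 2 = (y.val : ℂ) ^ 2 := by exact_mod_cast congrArg Units.val h1
  rcases sq_eq_sq_iff_eq_or_eq_neg.1 h2 with h3 | h3
  · exact Or.inl (SquareRootExtension.ext h (Units.ext h3))
  · refine Or.inr (SquareRootExtension.ext (h.trans (one_mul _).symm) ?_)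
    rw [negOne_mul_val]
    exact Units.ext h3

end SquareRootExtension

open SquareRootExtension in
/-- The square roots of `θ_g(z,z)⁻¹` can be chosen so that their coboundary is `γ_z`. -/
theorem exists_coboundary_sqrt {G : Type*} [Group G] [Finite G] (ω : NormalizedCocycle3 G) {z : G}
    (hz : z ≠ 1) (hzz : z * z = 1) (huniq : ∀ x : G, x * x = 1 → x = 1 ∨ x = z)
    (hzc : z ∈ Subgroup.center G) :
    ∃ τ : G → ℂˣ, (∀ h k, ω.gamma z h k = τ h * τ k / τ (h * k)) ∧
      ∀ g, ω.theta g z z * (τ g * τ g) = 1 := by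
  have hc : ∀ a : G, z⁻¹ * a * z = a := fun a => by
    rw [mul_assoc, Subgroup.mem_center_iff.1 hzc, inv_mul_cancel_left]
  have hsq : ∀ x : SquareRootExtension ω hzc hzz, (x * x).val =
      (ω.theta x.pt z z * ω.gamma z x.pt x.pt)⁻¹ := fun x => by
    rw [mul_val, ← pow_two, eq_inv_of_mul_eq_one_left x.sq_mul_theta, mul_inv, div_eq_mul_inv]
  obtain ⟨φ, hφ⟩ := exists_hom_of_unique_involution hz hzz huniq
    (proj (ω := ω) (hz := hzc) (hzz := hzz)) proj_surjective (ε := negOne)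
    (fun h => by
      have h1 := congrArg (fun x => (x.val : ℂ)) h
      norm_num [negOne] at h1) rfl
    (fun e he => by simpa using eq_or_eq_negOne_mul (x := e) (y := 1) he)
    -- Over `z`, the square of a lift is `ω(z,z,z)⁻²`, which is `1` by the cocycle identity.
    (fun u hu => by
      change u.pt = z at hu
      refine SquareRootExtension.ext (by rw [mul_pt, hu, hzz]; rfl) ?_
      have h1 := ω.cocycle z z z z
      rw [hzz, ω.map_one_left, ω.map_one_right, ω.map_one_mid] at h1
      rw [hsq, hu, one_val, inv_eq_one]
      simp only [NormalizedCocycle3.theta, NormalizedCocycle3.gamma, hc, hzz, inv_one, one_mul,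
        mul_one, mul_div_cancel_right] at h1 ⊢
      exact h1)
    (fun g h hg hh hgh => by
      refine SquareRootExtension.ext (hg.trans hh.symm) ?_
      rw [hsq, hsq]
      exact congrArg _ (ω.theta_mul_gamma_eq hzc hzz hg hh hgh))
  choose s hs using (proj_surjective (ω := ω) (hz := hzc) (hzz := hzz))
  -- Multiplying by the sign character makes the chosen root independent of the lift.
  let f : SquareRootExtension ω hzc hzz → ℂˣ := fun x => x.val * Units.map (Int.castRingHom ℂ) (φ x)
  have hf : ∀ x y, x.pt = y.pt → f x = f y := fun x y hxy => by
    rcases eq_or_eq_negOne_mul hxy with rfl | rfl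
    · rfl
    · simp [f, hφ, negOne_mul_val, -mul_val]
  have hfmul : ∀ x y, f (x * y) = f x * f y / ω.gamma z x.pt y.pt := fun x y => by
    simp only [f, map_mul, mul_val]
    rw [div_mul_eq_mul_div, mul_mul_mul_comm]
  refine ⟨fun g => f (s g), fun h k => ?_, fun g => ?_⟩
  · have hh : (s h).pt = h := hs h
    have hk : (s k).pt = k := hs k
    change _ = f (s h) * f (s k) / f (s (h * k))
    rw [hf (s (h * k)) (s h * s k) ((hs _).trans (by rw [mul_pt, hh, hk])), hfmul, hh, hk,
      div_div_cancel]
  · have hg : (s g).pt = g := hs g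
    have h1 := (s g).sq_mul_theta
    have h2 : f (s g) * f (s g) = (s g).val ^ 2 := by
      simp only [f]
      rw [mul_mul_mul_comm, ← map_mul, Int.units_mul_self, map_one, mul_one, sq]
    rw [h2, mul_comm]
    rwa [hg] at h1

/-! ### Admissibility -/

theorem mainTheorem2 {G : Type*} [Group G] [Fintype G]
    (A : Subgroup G) (hA : Nat.card A = 2)
    (huniq : ∀ B : Subgroup G, Nat.card B = 2 → B = A)
    (ω : NormalizedCocycle3 G) :
    IsAdmissible ω A := by
  classical
  obtain ⟨⟨z, hzA⟩, hz1, hzall⟩ := (Nat.card_eq_two_iff' (1 : A)).1 hA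
  have hmem : ∀ a : A, a = 1 ∨ a = ⟨z, hzA⟩ := fun a => or_iff_not_imp_left.2 (hzall a)
  have hz : z ≠ 1 := fun h => hz1 (Subtype.ext h)
  have hzz' : (⟨z, hzA⟩ : A) * ⟨z, hzA⟩ = 1 :=
    (hmem _).resolve_right fun h => hz1 (mul_eq_left.1 h)
  have hzz : z * z = 1 := congrArg Subtype.val hzz'
  have hinv : ∀ x : G, x * x = 1 → x = 1 ∨ x = z := fun x hx => by
    by_cases hx1 : x = 1
    · exact Or.inl hx1
    · right
      have h := huniq (Subgroup.zpowers x) (by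
        rw [Nat.card_zpowers, orderOf_eq_prime (by rw [sq, hx]) hx1])
      have hxA : x ∈ A := h ▸ Subgroup.mem_zpowers x
      exact congrArg Subtype.val
        ((hmem ⟨x, hxA⟩).resolve_left fun h => hx1 (congrArg Subtype.val h))
  have hzc : z ∈ Subgroup.center G := Subgroup.mem_center_iff.2 fun x => by
    rcases hinv (x * z * x⁻¹) (by
      rw [show x * z * x⁻¹ * (x * z * x⁻¹) = x * (z * z) * x⁻¹ by group, hzz]; group) with h | h
    · exact absurd (conj_eq_one_iff.1 h) hz
    · exact mul_inv_eq_iff_eq_mul.1 h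
  obtain ⟨τ, hτ, hτsq⟩ := exists_coboundary_sqrt ω hz hzz hinv hzc
  have hAZ : A ≤ TwistedDouble.Z ω := fun a ha => by
    rcases hmem ⟨a, ha⟩ with h | h
    · rw [show a = 1 from congrArg Subtype.val h]; exact one_mem _
    · rw [show a = z from congrArg Subtype.val h]; exact ⟨hzc, τ, hτ⟩
  obtain ⟨u, hu⟩ := TwistedDouble.exists_Gamma0_of_mem ω hzc hτ
  have hpu := TwistedDouble.p_eq ω u hu
  have huu : u * u = 1 := by
    refine Subtype.ext (Units.ext ?_)
    change ((u : (TwistedDouble ω)ˣ) : TwistedDouble ω) * (u : (TwistedDouble ω)ˣ) = 1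
    rw [hu, TwistedDouble.elt_mul_elt ω hzc, hzz, ← TwistedDouble.elt_one]
    exact congrArg (TwistedDouble.elt ω · 1) (funext hτsq)
  let v : TwistedDouble.Gamma0On ω A := ⟨u, by
    rw [TwistedDouble.Gamma0On, Subgroup.mem_comap, Subgroup.mem_subgroupOf, hpu]; exact hzA⟩
  have hvv : v * v = 1 := Subtype.ext huu
  -- As `v` lies over `z` and `v² = 1`, sending `z` to `v` is a splitting.
  let s : A →* TwistedDouble.Gamma0On ω A := MonoidHom.mk' (fun a => if a = 1 then 1 else v)
    fun a b => by
      rcases hmem a with rfl | rfl <;> rcases hmem b with rfl | rfl <;>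
        simp [hz1, hzz', hvv]
  refine ⟨hAZ, ⟨⟨s, fun a => ?_⟩⟩⟩
  rcases hmem a with rfl | rfl
  · exact (congrArg _ (map_one s)).trans (map_one _)
  · have hs : s ⟨z, hzA⟩ = v := if_neg hz1
    exact (congrArg _ hs).trans (Subtype.ext hpu)
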